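/- Let $N\ge 2$ and $c\in[0,1)$. Consider the following game between an administrator and applicants $1,\dots,N$. Applicant $n$ privately knows an ability $\theta_n\in(0,\infty)$; the abilities have no ties and all $N!$ rank orders are equally likely, while nothing is known about the values. The administrator commits to $\sigma=(\sigma_n)_{n=1}^N$, $\sigma_n:[0,\infty)^n\to[0,1]$; let $\Sigma$ be the set of all such $\sigma$. A strategy of applicant $n$ is a function $s_n:\Sigma\times[0,\infty)^{n-1}\times(0,\infty)\to\{0,1\}$. Applicants are invited in turn until one is accepted. When invited after the outputs $y_1,\dots,y_{n-1}$, applicant $n$ takes the action $a_n=s_n(\sigma,y_1,\dots,y_{n-1},\theta_n)$ ($1$: complete the interview, $0$: decline), the output $y_n=a_n\theta_n$ is observed, and applicant $n$ is accepted with probability $\sigma_n(y_1,\dots,y_n)$; a rejected applicant cannot be recalled. An action $a$ gives the applicant the expected payoff $\sigma_n(y_1,\dots,y_{n-1},a\theta_n)-ca$. For a set of $N$ distinct positive values, let the success probability of $(\sigma,s)$ at that set be the probability of accepting the best applicant when the values are assigned to the applicants in uniformly random order. The success probability $\pi(\sigma,s)$ is the infimum of these over all sets of values, i.e. the probability that is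 guaranteed by the equal likelihood of the rank orders (it is the common value whenever the set of values does not matter, e.g. if play depends on outputs and abilities only through their order). The applicants *best respond to $\sigma$* if, at every invitation that occurs with positive probability for some abilities without ties, $s_n(\sigma,\cdot)$ chooses an action of maximal expected payoff. A *Nash equilibrium* is a profile $(\sigma,s)$ such that the applicants best respond to $\sigma$ and $\pi(\sigma',s)\le\pi(\sigma,s)$ for all $\sigma'\in\Sigma$. A *full learning equilibrium* is a Nash equilibrium in which, for all abilities without ties and every $n$ that is invited with positive probability, $\max_{k\le n}\theta_k=\max_{k\le n}y_k$. Let $n^*=\min\{n\ge1:\sum_{k=n}^{N-1}\frac1k\le1\}$. Let $\sigma_n^*(y_1,\dots,y_n)$ be $0$ unless $0<y_n=\max_{k\le n}y_k$, in which case it is $c$ if $n<n^*$ and $1$ if $n\ge n^*$. Let $s^*$ be the applicants' profile that best responds to every $\sigma\in\Sigma$ after every history, where an indifferent applicant completes the interview if and only if the ability exceeds all past outputs. Let $v_N(0)=0$, $v_N(1)=\frac1N$ and, for $n=N-1,\dots,1$, $v_n(0)=\frac1n v_{n+1}(1)+v_{n+1}(0)$, $v_n(1)=\max\{\frac cN+(1-c)v_n(0),\frac1N\}$;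 put $\pi_N^*=v_1(1)$. Theorem (optimality of full learning). (1) $(\sigma^*,s^*)$ is a full learning equilibrium, the applicants in $s^*$ best respond to every $\sigma\in\Sigma$, and its success probability is $\pi_N^*$ (at every set of values). Every full learning equilibrium in which the applicants best respond to every $\sigma\in\Sigma$ (not only to the equilibrium strategy) has success probability $\pi_N^*$. (2) This is the highest success probability among all equilibria: $\pi(\sigma,s)\le\pi_N^*$ for every Nash equilibrium $(\sigma,s)$. The same bound holds for every profile $(\sigma,s)$ in which the applicants best respond to $\sigma$. -/

import Mathlib

open scoped NNReal

noncomputable section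

namespace HiringGame

/-- Possible abilities: the open half-line of positive reals. -/
abbrev Ability : Type := Set.Ioi (0 : ℝ≥0)

/-- Mixed strategies of the administrator. Applicants are indexed from `0` to `N - 1`;
`σ n y` is the probability of accepting applicant `n` when the observed outputs of the applicants
`0, …, n` are `y`. -/
abbrev AdminStrategy (N : ℕ) : Type := (n : Fin N) → (Fin (n + 1) → ℝ≥0) → unitInterval

/-- Strategies of the applicants: `s σ n h θ = true` means that applicant `n`, of ability `θ`,
completes the interview when the administrator has committed to `σ` and the outputs of the previous
applicants are `h`; `false` means that the applicant declines. -/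
abbrev ApplicantStrategy (N : ℕ) : Type :=
  AdminStrategy N → (n : Fin N) → (Fin n → ℝ≥0) → Ability → Bool

variable {N : ℕ}

/-- The output `a * θ` of an applicant of ability `θ` who takes action `a`. -/
def outputOf (a : Bool) (θ : Ability) : ℝ≥0 := if a then (θ : ℝ≥0) else 0

/-- The output of applicant `n` (if interviewed) when the abilities are `θ`. -/
def output (σ : AdminStrategy N) (s : ApplicantStrategy N) (θ : Fin N → Ability) (n : Fin N) :
    ℝ≥0 :=
  outputOf (s σ n (fun k : Fin n => output σ s θ ⟨k, k.2.trans n.2⟩) (θ n)) (θ n)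
termination_by n.val
decreasing_by exact k.2

/-- The outputs of the applicants preceding `n`. -/
def history (σ : AdminStrategy N) (s : ApplicantStrategy N) (θ : Fin N → Ability) (n : Fin N) :
    Fin n → ℝ≥0 :=
  fun k => output σ s θ ⟨k, k.2.trans n.2⟩

/-- The probability of accepting applicant `n`, once interviewed, when the abilities are `θ`. -/
def acceptProb (σ : AdminStrategy N) (s : ApplicantStrategy N) (θ : Fin N → Ability) (n : Fin N) :
    ℝ :=
  σ n (Fin.snoc (α := fun _ => ℝ≥0) (history σ s θ n) (output σ s θ n))

/-- The probability that applicant `n` is invited, i.e. that all previous applicants are rejected,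
when the abilities are `θ`. -/
def reachProb (σ : AdminStrategy N) (s : ApplicantStrategy N) (θ : Fin N → Ability) (n : Fin N) :
    ℝ :=
  ∏ k ∈ Finset.Iio n, (1 - acceptProb σ s θ k)

/-- The probability of hiring the best applicant when the abilities are `θ`. -/
def successGiven (σ : AdminStrategy N) (s : ApplicantStrategy N) (θ : Fin N → Ability) : ℝ :=
  ∑ n, reachProb σ s θ n * acceptProb σ s θ n * (if ∀ m, θ m ≤ θ n then 1 else 0)

/-- The probability of hiring the best applicant when the abilities are the distinct values `w`,
presented in a uniformly random order: each of the `N!` orders has probability `1 / N!`. -/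
def successProbAt (σ : AdminStrategy N) (s : ApplicantStrategy N) (w : Fin N ↪ Ability) : ℝ :=
  (∑ τ : Equiv.Perm (Fin N), successGiven σ s (fun n => w (τ n))) / (N.factorial : ℝ)

/-- The success probability. The beliefs specify only that there are no ties and that all rank
orders are equally likely, so it is the success probability guaranteed for all sets of values.
It coincides with `successProbAt σ s w` for every `w` when the latter does not depend on `w`, in
particular when the play depends on the abilities through their order only. -/
def successProb (σ : AdminStrategy N) (s : ApplicantStrategy N) : ℝ :=
  ⨅ w : Fin N ↪ Ability, successProbAt σ s w

/-- The expected payoff of applicant `n` of ability `θ` who takes action `a` after the history `h`: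
being accepted is worth `1`, and completing the interview costs `c`. -/
def applicantPayoff (c : ℝ) (σ : AdminStrategy N) (n : Fin N) (h : Fin n → ℝ≥0) (θ : Ability)
    (a : Bool) : ℝ :=
  σ n (Fin.snoc (α := fun _ => ℝ≥0) h (outputOf a θ)) - (if a then c else 0)

/-- The applicants best respond to `σ`: at every invitation that occurs with positive probability
for some abilities without ties, the chosen action is optimal for the applicant. -/
def ApplicantsBestRespond (c : ℝ) (σ : AdminStrategy N) (s : ApplicantStrategy N) : Prop :=
  ∀ θ : Fin N → Ability, Function.Injective θ → ∀ n : Fin N, 0 < reachProb σ s θ n →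
    ∀ a : Bool, applicantPayoff c σ n (history σ s θ n) (θ n) a ≤
      applicantPayoff c σ n (history σ s θ n) (θ n) (s σ n (history σ s θ n) (θ n))

/-- Nash equilibrium: the applicants best respond to `σ`, and the administrator, who commits to a
strategy that the applicants observe, has no profitable deviation. -/
def IsNashEquilibrium (c : ℝ) (σ : AdminStrategy N) (s : ApplicantStrategy N) : Prop :=
  ApplicantsBestRespond c σ s ∧ ∀ σ' : AdminStrategy N, successProb σ' s ≤ successProb σ s

/-- Along every path of play, the highest output so far equals the highest ability so far, for as
long as the game lasts. -/
def IsFullLearning (σ : AdminStrategy N) (s : ApplicantStrategy N) : Prop :=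
  ∀ θ : Fin N → Ability, Function.Injective θ → ∀ n : Fin N, 0 < reachProb σ s θ n →
    (Finset.Iic n).sup (fun k => (θ k : ℝ≥0)) = (Finset.Iic n).sup (fun k => output σ s θ k)

/-- Full learning equilibrium. -/
def IsFullLearningEquilibrium (c : ℝ) (σ : AdminStrategy N) (s : ApplicantStrategy N) : Prop :=
  IsNashEquilibrium c σ s ∧ IsFullLearning σ s

/-- The threshold `n* = min {n ≥ 1 : ∑_{k=n}^{N-1} 1/k ≤ 1}` (with applicants counted from `1`). -/
def threshold (N : ℕ) : ℕ :=
  sInf {n : ℕ | 1 ≤ n ∧ ∑ k ∈ Finset.Ico n N, (1 : ℝ) / (k : ℝ) ≤ 1}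

open scoped Classical in
/-- The threshold strategy: accept an applicant whose output is positive and maximal so far with
probability `c` before the threshold and `1` from the threshold on; reject all others.
Applicant `n : Fin N` has number `n + 1` when counting from `1`. -/
def thresholdStrategy (N : ℕ) (c : unitInterval) : AdminStrategy N := fun n y =>
  if 0 < y (Fin.last n) ∧ ∀ k, y k ≤ y (Fin.last n) then
    (if threshold N ≤ (n : ℕ) + 1 then 1 else c)
  else 0

open scoped Classical in
/-- The applicants' optimal response to every strategy of the administrator, where an indifferent
applicant completes the interview iff the ability exceeds all past outputs. -/
def optimalResponse (N : ℕ) (c : ℝ) : ApplicantStrategy N := fun σ n h θ =>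
  decide (applicantPayoff c σ n h θ false < applicantPayoff c σ n h θ true ∨
    (applicantPayoff c σ n h θ false = applicantPayoff c σ n h θ true ∧ ∀ k, h k < (θ : ℝ≥0)))

/-- The normalized values `(v_n(0), v_n(1))` for `n = N - j`:
`v_N(0) = 0`, `v_N(1) = 1/N`, `v_n(0) = v_{n+1}(1)/n + v_{n+1}(0)` and
`v_n(1) = max {c/N + (1-c) v_n(0), 1/N}`. -/
def normalizedValue (N : ℕ) (c : ℝ) : ℕ → ℝ × ℝ
  | 0 => (0, 1 / (N : ℝ))
  | j + 1 =>
    let v0 := (normalizedValue N c j).2 / ((N : ℝ) - ((j : ℝ) + 1)) + (normalizedValue N c j).1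
    (v0, max (c / (N : ℝ) + (1 - c) * v0) (1 / (N : ℝ)))

/-- The number `π*_N = v_1(1)`. -/
def fullLearningValue (N : ℕ) (c : ℝ) : ℝ := (normalizedValue N c (N - 1)).2

end HiringGame

end

/-!
The proof of the upper bound has two parts.

*Reduction to ordinal play.* Fix a strategy of the administrator and best responding applicants.
By Ramsey's theorem (`exists_orderEmbedding_invariant`) there are abilities among which all
actions, and all acceptance probabilities after rounding to a finite grid, depend on outputs
through their order only. The success probability is an infimum over sets of values, so it is at
most the one on these abilities. Rounding down to a grid that respects the bound `c` and the value
`1` loses arbitrarily little (`exists_ordinalPlay`). Best responses enter only through the fact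
that an applicant who completes the interview is accepted with probability at least `c`, while the
acceptance probability after declining cannot depend on the ability.

*Dynamic programming over order classes.* Consider all rank orders that agree on a set `K` of
applicants (`orderClass`), where the earlier applicants outside `K` have declined throughout the
class. By downward induction on the number of rejected applicants, the probability of success is
at most `contValue N c |K|`, the continuation value of full learning with `|K|` known abilities
(`OrdinalPlay.sum_tailSuccess_le`). If the next applicant `n` declines throughout the class, then
nothing is learned, and `n` may be treated like an applicant who is still to come. Otherwise the
position of `n` relative to `K` is revealed for free; the `|K| + 1` positions are equally likely.
If the top position is accepted with probability at least `c`, this is the dynamic programming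
equation. If not, `n` completes in some lower position, and there an accepted applicant is never
the best. This wasted acceptance costs at least as much as the acceptance with probability `c`
that full learning requires in the top position (`OrdinalPlay.sum_step_le`).

*Attainment.* If applicants who are the best so far complete, and only they are accepted, then the
success probability is the same for all values and solves a linear recursion
(`successProbAt_eq_policyValue`). For the threshold policy the solution is the value of full
learning (`contValue_rec_threshold`). If the applicants best respond to every strategy, the
administrator can deviate to accepting the best so far with probability slightly above `c` before
the threshold. This makes completing strictly optimal, so that no equilibrium falls short of the
value (`fullLearningValue_le_of_nash`).
-/

namespace HiringGame

/-! ### Rank orders with a prescribed order on a set of applicants -/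

/-- The rank orders that order the applicants in `K` in the same way as `ρ`. A rank order is
encoded as a permutation: `τ i < τ j` means that applicant `j` is better than applicant `i`. -/
def orderClass {N : ℕ} (K : Finset (Fin N)) (ρ : Equiv.Perm (Fin N)) :
    Finset (Equiv.Perm (Fin N)) :=
  Finset.univ.filter fun τ => ∀ i ∈ K, ∀ j ∈ K, (τ i < τ j ↔ ρ i < ρ j)

section OrderClass

variable {N : ℕ} {K K' : Finset (Fin N)} {ρ τ : Equiv.Perm (Fin N)}

theorem mem_orderClass : τ ∈ orderClass K ρ ↔ ∀ i ∈ K, ∀ j ∈ K, (τ i < τ j ↔ ρ i < ρ j) := by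
  simp [orderClass]

theorem self_mem_orderClass : ρ ∈ orderClass K ρ := by simp [mem_orderClass]

theorem orderClass_eq_of_mem (h : τ ∈ orderClass K ρ) : orderClass K τ = orderClass K ρ := by
  ext π
  rw [mem_orderClass] at h
  simp only [mem_orderClass]
  exact forall₂_congr fun i hi => forall₂_congr fun j hj => by rw [h i hi j hj]

theorem mem_orderClass_comm : τ ∈ orderClass K ρ ↔ ρ ∈ orderClass K τ := by
  simp only [mem_orderClass]
  exact forall₂_congr fun i _ => forall₂_congr fun j _ => Iff.comm

theorem orderClass_anti (h : K ⊆ K') : orderClass K' ρ ⊆ orderClass K ρ := fun π hπ => by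
  rw [mem_orderClass] at hπ ⊢
  exact fun i hi j hj => hπ i (h hi) j (h hj)

theorem orderClass_subset_of_mem (h : K ⊆ K') (hτ : τ ∈ orderClass K ρ) :
    orderClass K' τ ⊆ orderClass K ρ :=
  orderClass_eq_of_mem hτ ▸ orderClass_anti h

/-- Two injective rankings of a finite set agree up to a unique rearrangement. -/
theorem existsUnique_perm_lt_iff {ι α β : Type*} [Fintype ι] [LinearOrder α] [LinearOrder β]
    (f : ι → α) (hf : Function.Injective f) (f' : ι → β) (hf' : Function.Injective f') :
    ∃! g : Equiv.Perm ι, ∀ i j, f i < f j ↔ f' (g i) < f' (g j) := by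
  let l : LinearOrder ι := LinearOrder.lift' f hf
  let l' : LinearOrder ι := LinearOrder.lift' f' hf'
  have e := @Fintype.orderIsoFinOfCardEq ι l _ (Fintype.card ι) rfl
  have e' := @Fintype.orderIsoFinOfCardEq ι l' _ (Fintype.card ι) rfl
  let g₀ : Equiv.Perm ι := e.toEquiv.symm.trans e'.toEquiv
  have hg₀ : ∀ i j : ι, (l'.lt (g₀ i) (g₀ j) ↔ l.lt i j) := fun i j =>
    (@OrderIso.lt_iff_lt _ _ _ l'.toPreorder e' _ _).trans <|
      (@OrderIso.lt_iff_lt _ _ _ l.toPreorder e _ _).symm.trans <| by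
        change l.lt (e.toEquiv (e.toEquiv.symm i)) (e.toEquiv (e.toEquiv.symm j)) ↔ _
        rw [Equiv.apply_symm_apply, Equiv.apply_symm_apply]
  refine ⟨g₀, fun i j => (hg₀ i j).symm, fun g hg => ?_⟩
  have : @WellFoundedLT ι l'.toLT := @Finite.to_wellFoundedLT ι _ l'.toPreorder
  have : IsWellOrder ι l'.lt := @isWellOrder_lt ι l' this
  let r : l.lt ≃r l'.lt := ⟨g, fun {i j} => (hg i j).symm⟩
  let r₀ : l.lt ≃r l'.lt := ⟨g₀, fun {i j} => hg₀ i j⟩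
  exact Equiv.ext fun i => InitialSeg.eq r.toInitialSeg r₀.toInitialSeg i

theorem existsUnique_mem_orderClass_mul_ofSubtype (K : Finset (Fin N))
    (ρ τ : Equiv.Perm (Fin N)) :
    ∃! g : Equiv.Perm K, τ ∈ orderClass K (ρ * Equiv.Perm.ofSubtype g) := by
  refine (existsUnique_congr fun g => ?_).2 (existsUnique_perm_lt_iff (fun i : K => τ i)
    (fun _ _ h => Subtype.ext (τ.injective h)) (fun i : K => ρ i)
    (fun _ _ h => Subtype.ext (ρ.injective h)))
  rw [mem_orderClass]
  constructor
  · intro h i j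
    simpa only [Equiv.Perm.mul_apply, Equiv.Perm.ofSubtype_apply_coe] using h i i.2 j j.2
  · intro h i hi j hj
    have e1 : Equiv.Perm.ofSubtype g i = g ⟨i, hi⟩ := Equiv.Perm.ofSubtype_apply_coe g ⟨i, hi⟩
    have e2 : Equiv.Perm.ofSubtype g j = g ⟨j, hj⟩ := Equiv.Perm.ofSubtype_apply_coe g ⟨j, hj⟩
    rw [Equiv.Perm.mul_apply, Equiv.Perm.mul_apply, e1, e2]
    exact h ⟨i, hi⟩ ⟨j, hj⟩

theorem card_orderClass_mul_ofSubtype (g : Equiv.Perm K) :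
    (orderClass K (ρ * Equiv.Perm.ofSubtype g)).card = (orderClass K ρ).card := by
  have hg : ∀ (g : Equiv.Perm K) (i), i ∈ K → Equiv.Perm.ofSubtype g i ∈ K := fun g i hi => by
    have := Equiv.Perm.ofSubtype_apply_coe g ⟨i, hi⟩
    rw [this]; exact (g ⟨i, hi⟩).2
  refine Finset.card_bij' (fun π _ => π * (Equiv.Perm.ofSubtype g)⁻¹)
    (fun π _ => π * Equiv.Perm.ofSubtype g) ?_ ?_ ?_ ?_
  · intro π hπ
    rw [mem_orderClass] at hπ ⊢
    intro i hi j hj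
    have := hπ ((Equiv.Perm.ofSubtype g)⁻¹ i) (by rw [← map_inv]; exact hg _ i hi)
      ((Equiv.Perm.ofSubtype g)⁻¹ j) (by rw [← map_inv]; exact hg _ j hj)
    simpa using this
  · intro π hπ
    rw [mem_orderClass] at hπ ⊢
    intro i hi j hj
    exact hπ _ (hg g i hi) _ (hg g j hj)
  · intro π _; simp
  · intro π _; simp

/-- Each of the `|K|!` orders of `K` is equally likely, since rearranging `K` permutes the order
classes. -/
theorem card_orderClass (K : Finset (Fin N)) (ρ : Equiv.Perm (Fin N)) :
    (orderClass K ρ).card * K.card.factorial = N.factorial := by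
  classical
  have h1 : ∑ g : Equiv.Perm K, (orderClass K (ρ * Equiv.Perm.ofSubtype g)).card
      = ∑ τ : Equiv.Perm (Fin N), 1 := by
    have : ∀ g : Equiv.Perm K, (orderClass K (ρ * Equiv.Perm.ofSubtype g)).card
        = ∑ τ : Equiv.Perm (Fin N),
          if τ ∈ orderClass K (ρ * Equiv.Perm.ofSubtype g) then 1 else 0 := fun g => by simp
    simp_rw [this]
    rw [Finset.sum_comm]
    refine Finset.sum_congr rfl fun τ _ => ?_
    obtain ⟨g, hg, hu⟩ := existsUnique_mem_orderClass_mul_ofSubtype K ρ τ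
    rw [Finset.sum_eq_single g (fun b _ hb => if_neg fun h => hb (hu b h)) (by simp), if_pos hg]
  simp_rw [card_orderClass_mul_ofSubtype] at h1
  simpa [Fintype.card_perm, mul_comm] using h1

theorem card_orderClass_pos : 0 < (orderClass K ρ).card :=
  Finset.card_pos.2 ⟨ρ, self_mem_orderClass⟩

theorem card_orderClass_insert {n : Fin N} (hn : n ∉ K) (ρ τ : Equiv.Perm (Fin N)) :
    (orderClass (insert n K) τ).card * (K.card + 1) = (orderClass K ρ).card := by
  have h1 := card_orderClass (insert n K) τ
  have h2 := card_orderClass K ρ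
  rw [Finset.card_insert_of_notMem hn, Nat.factorial_succ, ← mul_assoc] at h1
  exact Nat.eq_of_mul_eq_mul_right (Nat.factorial_pos _) (h1.trans h2.symm)

/-- Summing over an order class may be done by first averaging over the finer classes obtained by
ordering one more applicant `n`. -/
theorem sum_orderClass_insert {n : Fin N} (hn : n ∉ K) (ρ : Equiv.Perm (Fin N))
    (F : Equiv.Perm (Fin N) → ℝ) :
    ∑ τ ∈ orderClass K ρ, ∑ π ∈ orderClass (insert n K) τ, F π =
      ((orderClass K ρ).card / (K.card + 1) : ℝ) * ∑ τ ∈ orderClass K ρ, F τ := by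
  have h1 : ∑ τ ∈ orderClass K ρ, ∑ π ∈ orderClass (insert n K) τ, F π =
      ∑ π ∈ orderClass K ρ, ∑ τ ∈ orderClass (insert n K) π, F π := by
    refine Finset.sum_comm' fun τ π => ⟨fun ⟨h, h'⟩ => ?_, fun ⟨h, h'⟩ => ?_⟩
    · exact ⟨mem_orderClass_comm.1 h', orderClass_subset_of_mem (Finset.subset_insert n K) h h'⟩
    · exact ⟨orderClass_subset_of_mem (Finset.subset_insert n K) h' h, mem_orderClass_comm.1 h⟩
  rw [h1, Finset.mul_sum]
  refine Finset.sum_congr rfl fun π _ => ?_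
  rw [Finset.sum_const, nsmul_eq_mul, ← card_orderClass_insert hn ρ π]
  have : (K.card + 1 : ℝ) ≠ 0 := by positivity
  push_cast
  field_simp

/-- Distinct scores determine a rank order. -/
theorem exists_perm_lt_iff {α : Type*} [LinearOrder α] (f : Fin N → α)
    (hf : Function.Injective f) : ∃ ρ : Equiv.Perm (Fin N), ∀ i j, ρ i < ρ j ↔ f i < f j := by
  have hm : StrictMono (f ∘ Tuple.sort f) :=
    (Tuple.monotone_sort f).strictMono_of_injective (hf.comp (Tuple.sort f).injective)
  refine ⟨(Tuple.sort f)⁻¹, fun i j => ?_⟩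
  rw [← hm.lt_iff_lt]
  simp

/-- The rank orders in an order class of `K` for which a further applicant `n` beats all of `K` form
one of the finer order classes. -/
theorem exists_orderClass_insert_top {n : Fin N} (hn : n ∉ K) (ρ : Equiv.Perm (Fin N)) :
    ∃ ρ' ∈ orderClass K ρ, (orderClass K ρ).filter (fun τ => ∀ k ∈ K, τ k < τ n) =
      orderClass (insert n K) ρ' := by
  obtain ⟨ρ', hρ'⟩ := exists_perm_lt_iff (fun i => if i = n then N else (ρ i : ℕ)) (by
    intro i j hij
    have hi := (ρ i).2
    have hj := (ρ j).2
    by_cases h1 : i = n <;> by_cases h2 : j = n <;> simp only [h1, h2, if_true, if_false] at hij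
    · rw [h1, h2]
    · omega
    · omega
    · exact ρ.injective (Fin.ext hij))
  have hne : ∀ i ∈ K, i ≠ n := fun i hi h => hn (h ▸ hi)
  have hmem : ρ' ∈ orderClass K ρ := by
    rw [mem_orderClass]
    intro i hi j hj
    rw [hρ', if_neg (hne i hi), if_neg (hne j hj), Fin.lt_def]
  have htop : ∀ k ∈ K, ρ' k < ρ' n := fun k hk => by
    rw [hρ', if_neg (hne k hk), if_pos rfl]; exact (ρ k).2
  refine ⟨ρ', hmem, ?_⟩
  ext τ
  rw [Finset.mem_filter, ← orderClass_eq_of_mem hmem, mem_orderClass, mem_orderClass]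
  constructor
  · rintro ⟨h1, h2⟩ i hi j hj
    rw [Finset.mem_insert] at hi hj
    rcases hi with rfl | hi <;> rcases hj with rfl | hj
    · simp
    · simp [(h2 j hj).not_gt, (htop j hj).not_gt]
    · simp [(h2 i hi), (htop i hi)]
    · exact h1 i hi j hj
  · intro h
    exact ⟨fun i hi j hj => h i (Finset.mem_insert_of_mem hi) j (Finset.mem_insert_of_mem hj),
      fun k hk => (h k (Finset.mem_insert_of_mem hk) n (Finset.mem_insert_self n K)).2 (htop k hk)⟩

/-- Given the order on `K`, a further applicant beats all of `K` with probability
`1 / (|K| + 1)`. -/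
theorem card_filter_top {n : Fin N} (hn : n ∉ K) (ρ : Equiv.Perm (Fin N)) :
    ((orderClass K ρ).filter (fun τ => ∀ k ∈ K, τ k < τ n)).card * (K.card + 1) =
      (orderClass K ρ).card := by
  obtain ⟨ρ', _, h⟩ := exists_orderClass_insert_top hn ρ
  rw [h, card_orderClass_insert hn ρ]

/-- Indicator that applicant `m` is the best one under the rank order `τ`. -/
def bestInd (τ : Equiv.Perm (Fin N)) (m : Fin N) : ℝ := if ∀ i, τ i ≤ τ m then 1 else 0

theorem sum_bestInd_eq_zero {m k : Fin N} (hk : k ∈ K) (hm : m ∈ K) (h : ρ m < ρ k) :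
    ∑ τ ∈ orderClass K ρ, bestInd τ m = 0 :=
  Finset.sum_eq_zero fun _ hτ => if_neg fun hb =>
    (hb k).not_gt ((mem_orderClass.1 hτ m hm k hk).2 h)

/-- Given the order on `K`, the best applicant in `K` is the best overall with probability
`|K| / N`. -/
theorem sum_bestInd_of_top {m : Fin N} (hm : m ∈ K) (h : ∀ k ∈ K, ρ k ≤ ρ m) :
    ∑ τ ∈ orderClass K ρ, bestInd τ m = (orderClass K ρ).card * (K.card / N : ℝ) := by
  obtain ⟨j, hj⟩ : ∃ j, K.card + j = N := ⟨N - K.card, by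
    have := K.card_le_univ; simp at this; omega⟩
  have hN : 0 < N := m.pos
  induction j generalizing K ρ with
  | zero =>
    have hK : K = Finset.univ := (Finset.card_eq_iff_eq_univ K).1 (by simpa using hj)
    subst hK
    have h1 : ∀ τ ∈ orderClass Finset.univ ρ, bestInd τ m = 1 := by
      refine fun τ hτ => if_pos fun i => ?_
      by_contra hlt
      exact (h i (Finset.mem_univ i)).not_gt
        ((mem_orderClass.1 hτ m (Finset.mem_univ m) i (Finset.mem_univ i)).1 (not_le.1 hlt))
    rw [Finset.sum_congr rfl h1]
    simp [hN.ne']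
  | succ j ih =>
    obtain ⟨n, hn⟩ : ∃ n, n ∉ K := by
      by_contra! hall
      have : K = Finset.univ := Finset.eq_univ_iff_forall.2 hall
      subst this
      simp at hj
    have hK' : (insert n K).card = K.card + 1 := Finset.card_insert_of_notMem hn
    have hav := sum_orderClass_insert hn ρ (fun τ => bestInd τ m)
    have hin : ∀ τ ∈ orderClass K ρ, ∑ π ∈ orderClass (insert n K) τ, bestInd π m =
        if ∀ k ∈ K, τ k < τ n then 0 else
          ((orderClass K ρ).card / (K.card + 1) : ℝ) * ((K.card + 1) / N) := by
      intro τ hτ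
      have hτm : ∀ k ∈ K, τ k ≤ τ m := fun k hk => by
        by_contra hlt
        exact (h k hk).not_gt ((mem_orderClass.1 hτ m hm k hk).1 (not_le.1 hlt))
      split_ifs with htop
      · exact sum_bestInd_eq_zero (Finset.mem_insert_self n K) (Finset.mem_insert_of_mem hm)
          (htop m hm)
      · push Not at htop
        obtain ⟨k, hk, hkn⟩ := htop
        rw [ih (Finset.mem_insert_of_mem hm) (fun i hi => ?_) (by omega), hK',
          ← card_orderClass_insert hn ρ τ]
        · push_cast
          field_simp
        · rcases Finset.mem_insert.1 hi with rfl | hi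
          · exact hkn.trans (hτm k hk)
          · exact hτm i hi
    rw [Finset.sum_congr rfl hin, Finset.sum_ite, Finset.sum_const_zero, zero_add,
      Finset.sum_const, nsmul_eq_mul] at hav
    have hc := card_filter_top hn ρ
    have hs := Finset.card_filter_add_card_filter_not (s := orderClass K ρ)
      (fun τ => ∀ k ∈ K, τ k < τ n)
    have hpos : (0 : ℝ) < (orderClass K ρ).card := by exact_mod_cast card_orderClass_pos
    set C : ℝ := ((orderClass K ρ).card : ℝ)
    set x := ((orderClass K ρ).filter (fun τ => ∀ k ∈ K, τ k < τ n)).card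
    set y := ((orderClass K ρ).filter (fun τ => ¬ ∀ k ∈ K, τ k < τ n)).card
    have hc' : (x : ℝ) * (K.card + 1) = C := by
      rw [← Nat.cast_add_one, ← Nat.cast_mul, hc]
    have hs' : (x : ℝ) + y = C := by rw [← Nat.cast_add, hs]
    have hy : (y : ℝ) = x * K.card := by linarith
    have hk1 : (K.card + 1 : ℝ) ≠ 0 := by positivity
    have hav' : C / (K.card + 1) * ((y : ℝ) * ((K.card + 1) / N)) =
      C / (K.card + 1) * ∑ τ ∈ orderClass K ρ, bestInd τ m := by rw [← hav]; ring
    rw [← mul_left_cancel₀ (by positivity) hav', hy, ← hc']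
    ring

/-- Given the order on `K`, an applicant outside `K` is the best overall with probability
`1 / N`. -/
theorem sum_bestInd_of_notMem {n : Fin N} (hn : n ∉ K) (ρ : Equiv.Perm (Fin N)) :
    ∑ τ ∈ orderClass K ρ, bestInd τ n = (orderClass K ρ).card / (N : ℝ) := by
  obtain ⟨ρ', hρ', h⟩ := exists_orderClass_insert_top hn ρ
  have hsub : (orderClass K ρ).filter (fun τ => ∀ k ∈ K, τ k < τ n) ⊆ orderClass K ρ :=
    Finset.filter_subset _ _
  have hz : ∀ τ ∈ orderClass K ρ, τ ∉ (orderClass K ρ).filter (fun τ => ∀ k ∈ K, τ k < τ n) →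
      bestInd τ n = 0 := fun τ hτ hτ' => if_neg fun hb => hτ' <| Finset.mem_filter.2
    ⟨hτ, fun k hk => (hb k).lt_of_ne fun he => hn (τ.injective he ▸ hk)⟩
  rw [← Finset.sum_subset hsub hz, h]
  have htop : ρ' ∈ (orderClass K ρ).filter (fun τ => ∀ k ∈ K, τ k < τ n) :=
    h ▸ self_mem_orderClass
  rw [sum_bestInd_of_top (Finset.mem_insert_self n K) fun k hk => ?_,
    ← card_orderClass_insert hn ρ ρ', Finset.card_insert_of_notMem hn]
  · push_cast; ring
  · rcases Finset.mem_insert.1 hk with rfl | hk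
    · exact le_rfl
    · exact ((Finset.mem_filter.1 htop).2 k hk).le

end OrderClass

/-! ### Continuation values of full learning -/

/-- The probability of success under full learning when the abilities of `ℓ` applicants are known
and all of them have been rejected: `ℓ * v_ℓ(0)` if `ℓ` is positive, and `π*_N` at the start. -/
noncomputable def contValue (N : ℕ) (c : ℝ) (ℓ : ℕ) : ℝ :=
  if ℓ = 0 then fullLearningValue N c else ℓ * (normalizedValue N c (N - ℓ)).1

section ContValue

variable {N : ℕ} {c : ℝ}

theorem normalizedValue_snd (hc : c ≤ 1) (j : ℕ) : (normalizedValue N c j).2 =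
    max (c / N + (1 - c) * (normalizedValue N c j).1) (1 / N) := by
  cases j with
  | zero =>
    simp only [normalizedValue, mul_zero, add_zero]
    rw [max_eq_right]
    gcongr
  | succ j => simp [normalizedValue]

theorem inv_le_normalizedValue_snd (hc : c ≤ 1) (j : ℕ) :
    1 / N ≤ (normalizedValue N c j).2 := by
  rw [normalizedValue_snd hc]; exact le_max_right _ _

theorem normalizedValue_fst_nonneg (hc : c ≤ 1) {j : ℕ} (hj : j < N) :
    0 ≤ (normalizedValue N c j).1 := by
  induction j with
  | zero => simp [normalizedValue]
  | succ j ih =>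
    simp only [normalizedValue]
    have h1 : 0 ≤ (normalizedValue N c j).2 :=
      le_trans (by positivity) (inv_le_normalizedValue_snd hc j)
    have h2 : (j : ℝ) + 1 ≤ N := by exact_mod_cast hj.le
    exact add_nonneg (div_nonneg h1 (by linarith)) (ih (by omega))

theorem contValue_self (hN : 0 < N) : contValue N c N = 0 := by
  simp [contValue, hN.ne', normalizedValue]

theorem contValue_nonneg (hc : c ≤ 1) (ℓ : ℕ) : 0 ≤ contValue N c ℓ := by
  unfold contValue
  split_ifs with h
  · exact le_trans (by positivity) (inv_le_normalizedValue_snd hc _)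
  · rcases Nat.eq_zero_or_pos N with rfl | hN
    · simp [normalizedValue]
    · exact mul_nonneg (by positivity) (normalizedValue_fst_nonneg hc (by omega))

/-- Dynamic programming equation: the next applicant is the best so far with probability
`1 / (ℓ + 1)`. -/
theorem contValue_rec (hc : c ≤ 1) {ℓ : ℕ} (hℓ : ℓ < N) :
    (ℓ + 1) * contValue N c ℓ =
      max (c * ((ℓ + 1) / N) + (1 - c) * contValue N c (ℓ + 1)) ((ℓ + 1) / N)
        + ℓ * contValue N c (ℓ + 1) := by
  have hmul : ∀ v : ℝ, max (c * ((ℓ + 1) / N) + (1 - c) * ((ℓ + 1) * v)) ((ℓ + 1) / N) =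
      (ℓ + 1) * max (c / N + (1 - c) * v) (1 / N) := fun v => by
    rw [mul_max_of_nonneg _ _ (by positivity : (0 : ℝ) ≤ ℓ + 1)]
    congr 1 <;> ring
  have h1 : contValue N c (ℓ + 1) = (ℓ + 1) * (normalizedValue N c (N - (ℓ + 1))).1 := by
    simp [contValue]
  rw [h1, hmul, ← normalizedValue_snd hc]
  rcases Nat.eq_zero_or_pos ℓ with rfl | h0
  · simp [contValue, fullLearningValue]
  · obtain ⟨j, rfl⟩ : ∃ j, N = ℓ + (j + 1) := ⟨N - ℓ - 1, by omega⟩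
    have e1 : ℓ + (j + 1) - ℓ = j + 1 := by omega
    have e2 : ℓ + (j + 1) - (ℓ + 1) = j := by omega
    have h0' : (ℓ : ℝ) ≠ 0 := by exact_mod_cast h0.ne'
    rw [contValue, if_neg h0.ne', e1, e2, normalizedValue]
    have e3 : ((ℓ + (j + 1) : ℕ) : ℝ) - ((j : ℝ) + 1) = ℓ := by push_cast; ring
    simp only [e3]
    field_simp

theorem inv_le_contValue (hc : c ≤ 1) {ℓ : ℕ} (hℓ : ℓ < N) : 1 / N ≤ contValue N c ℓ := by
  have h1 := contValue_rec hc hℓ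
  have h2 : ((ℓ : ℝ) + 1) * (1 / N) ≤ (ℓ + 1) * contValue N c ℓ := by
    rw [h1]
    have := le_max_right (c * ((ℓ + 1) / N) + (1 - c) * contValue N c (ℓ + 1)) ((ℓ + 1) / N : ℝ)
    have := mul_nonneg (Nat.cast_nonneg ℓ) (contValue_nonneg (N := N) hc (ℓ + 1))
    have e : ((ℓ : ℝ) + 1) * (1 / N) = (ℓ + 1) / N := by ring
    linarith
  exact le_of_mul_le_mul_left h2 (by positivity)

end ContValue

/-! ### Success probabilities along a rank order -/

section Tail

variable {N : ℕ}

/-- The probability of rejecting the first `n` applicants if applicant `k` is accepted with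
probability `p k`. -/
def reachTo (p : Fin N → ℝ) (n : ℕ) : ℝ :=
  ∏ k ∈ Finset.univ.filter (fun k : Fin N => (k : ℕ) < n), (1 - p k)

/-- The probability of accepting the best applicant and not accepting any of the first `n`, if
applicant `k` is accepted with probability `p k` and the rank order is `τ`. -/
def tailSuccess (p : Fin N → ℝ) (τ : Equiv.Perm (Fin N)) (n : ℕ) : ℝ :=
  ∑ m ∈ Finset.univ.filter (fun m : Fin N => n ≤ (m : ℕ)), reachTo p m * p m * bestInd τ m

theorem reachTo_zero (p : Fin N → ℝ) : reachTo p 0 = 1 := by simp [reachTo]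

theorem reachTo_succ (p : Fin N → ℝ) (n : Fin N) :
    reachTo p (n + 1) = reachTo p n * (1 - p n) := by
  have : (Finset.univ.filter fun k : Fin N => (k : ℕ) < n + 1) =
      insert n (Finset.univ.filter fun k : Fin N => (k : ℕ) < n) := by
    ext k
    simp only [Finset.mem_filter, Finset.mem_univ, true_and, Finset.mem_insert, Fin.ext_iff]
    omega
  rw [reachTo, this, Finset.prod_insert (by simp), mul_comm]
  rfl

theorem reachTo_nonneg {p : Fin N → ℝ} (hp : ∀ k, p k ≤ 1) (n : ℕ) : 0 ≤ reachTo p n :=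
  Finset.prod_nonneg fun k _ => sub_nonneg.2 (hp k)

theorem reachTo_congr {p q : Fin N → ℝ} {n : ℕ} (h : ∀ k : Fin N, (k : ℕ) < n → p k = q k) :
    reachTo p n = reachTo q n :=
  Finset.prod_congr rfl fun k hk => by rw [h k (Finset.mem_filter.1 hk).2]

theorem tailSuccess_eq_add (p : Fin N → ℝ) (τ : Equiv.Perm (Fin N)) (n : Fin N) :
    tailSuccess p τ n = reachTo p n * p n * bestInd τ n + tailSuccess p τ (n + 1) := by
  have : (Finset.univ.filter fun k : Fin N => (n : ℕ) ≤ k) =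
      insert n (Finset.univ.filter fun k : Fin N => (n + 1 : ℕ) ≤ k) := by
    ext k
    simp only [Finset.mem_filter, Finset.mem_univ, true_and, Finset.mem_insert, Fin.ext_iff]
    omega
  rw [tailSuccess, this, Finset.sum_insert (by simp)]
  rfl

theorem tailSuccess_self (p : Fin N → ℝ) (τ : Equiv.Perm (Fin N)) : tailSuccess p τ N = 0 := by
  rw [tailSuccess, Finset.filter_false_of_mem fun k _ => by simp, Finset.sum_empty]

theorem tailSuccess_zero (p : Fin N → ℝ) (τ : Equiv.Perm (Fin N)) :
    tailSuccess p τ 0 = ∑ m : Fin N, reachTo p m * p m * bestInd τ m := by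
  simp [tailSuccess]

theorem tailSuccess_eq_zero {p : Fin N → ℝ} {n : ℕ} (h : reachTo p n = 0)
    (τ : Equiv.Perm (Fin N)) : tailSuccess p τ n = 0 := by
  refine Finset.sum_eq_zero fun m hm => ?_
  obtain ⟨k, hk, hk0⟩ := Finset.prod_eq_zero_iff.1 h
  have hkm : k ∈ Finset.univ.filter fun k : Fin N => (k : ℕ) < m := by
    simp only [Finset.mem_filter, Finset.mem_univ, true_and] at hk hm ⊢
    omega
  rw [reachTo, Finset.prod_eq_zero hkm hk0, zero_mul, zero_mul]

/-- Summing the tail over the finer classes, the applicant `n` who is ordered next contributes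
only if better than all of `K`. -/
theorem sum_tailSuccess_insert {K : Finset (Fin N)} {n : Fin N} (hn : n ∉ K)
    (ρ : Equiv.Perm (Fin N)) (p : Equiv.Perm (Fin N) → Fin N → ℝ)
    (hp : ∀ τ ∈ orderClass K ρ, ∀ π ∈ orderClass (insert n K) τ, ∀ k ≤ n, p π k = p τ k) :
    ((orderClass K ρ).card / (K.card + 1) : ℝ) *
        ∑ τ ∈ orderClass K ρ, tailSuccess (p τ) τ n =
      ∑ τ ∈ orderClass K ρ,
        (reachTo (p τ) n * p τ n *
            (if ∀ k ∈ K, τ k < τ n then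
              ((orderClass K ρ).card / (K.card + 1) : ℝ) * ((K.card + 1) / N) else 0) +
          ∑ π ∈ orderClass (insert n K) τ, tailSuccess (p π) π (n + 1)) := by
  rw [← sum_orderClass_insert hn]
  refine Finset.sum_congr rfl fun τ hτ => ?_
  have h1 : ∀ π ∈ orderClass (insert n K) τ, tailSuccess (p π) π n =
      reachTo (p τ) n * p τ n * bestInd π n + tailSuccess (p π) π (n + 1) := fun π hπ => by
    rw [tailSuccess_eq_add, hp τ hτ π hπ n le_rfl,
      reachTo_congr fun k hk => hp τ hτ π hπ k (Fin.le_def.2 hk.le)]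
  rw [Finset.sum_congr rfl h1, Finset.sum_add_distrib, ← Finset.mul_sum]
  congr 2
  split_ifs with htop
  · rw [sum_bestInd_of_top (Finset.mem_insert_self n K), Finset.card_insert_of_notMem hn,
      ← card_orderClass_insert hn ρ τ]
    · push_cast
      field_simp
    · intro k hk
      rcases Finset.mem_insert.1 hk with rfl | hk
      · exact le_rfl
      · exact (htop k hk).le
  · push Not at htop
    obtain ⟨k, hk, hkn⟩ := htop
    exact sum_bestInd_eq_zero (Finset.mem_insert_of_mem hk) (Finset.mem_insert_self n K)
      (hkn.lt_of_ne fun h => hn (τ.injective h ▸ hk))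

end Tail

/-! ### The bound for play that depends on the rank order only -/

/-- Play that depends on the abilities through their order only: under the rank order `τ`, applicant
`n` completes the interview iff `act τ n`, and is accepted with probability `acc τ n`. The action of
an applicant depends on the order of the predecessors who complete and on the applicant's own
position relative to them; the acceptance probability depends on the order of those who complete, up
to and including the applicant. Completing must be rewarded by an acceptance probability of at
least `c`. -/
structure OrdinalPlay (N : ℕ) (c : ℝ) where
  act : Equiv.Perm (Fin N) → Fin N → Bool
  acc : Equiv.Perm (Fin N) → Fin N → ℝ
  acc_nonneg : ∀ τ n, 0 ≤ acc τ n
  acc_le_one : ∀ τ n, acc τ n ≤ 1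
  act_eq : ∀ τ π n, (∀ k < n, act τ k = act π k) →
    (∀ i j, (i < n ∧ act τ i = true ∨ i = n) → (j < n ∧ act τ j = true ∨ j = n) →
      (τ i < τ j ↔ π i < π j)) → act τ n = act π n
  acc_eq : ∀ τ π n, (∀ k ≤ n, act τ k = act π k) →
    (∀ i j, i ≤ n → j ≤ n → act τ i = true → act τ j = true → (τ i < τ j ↔ π i < π j)) →
      acc τ n = acc π n
  le_acc : ∀ (τ) (n : Fin N), 0 < reachTo (acc τ) n → act τ n = true → c ≤ acc τ n

namespace OrdinalPlay

variable {N : ℕ} {c : ℝ} (P : OrdinalPlay N c)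

/-- The first `n` applicants behave in the same way under all rank orders in the class of `ρ`, and
those outside `K` decline, so that nothing is known about them. -/
structure Determined (K : Finset (Fin N)) (ρ : Equiv.Perm (Fin N)) (n : ℕ) : Prop where
  lt_of_mem : ∀ k ∈ K, (k : ℕ) < n
  act_eq : ∀ τ ∈ orderClass K ρ, ∀ k : Fin N, (k : ℕ) < n → P.act τ k = P.act ρ k
  acc_eq : ∀ τ ∈ orderClass K ρ, ∀ k : Fin N, (k : ℕ) < n → P.acc τ k = P.acc ρ k
  mem_of_act : ∀ k : Fin N, (k : ℕ) < n → P.act ρ k = true → k ∈ K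

variable {P} {K : Finset (Fin N)} {ρ τ : Equiv.Perm (Fin N)} {n : Fin N}

theorem Determined.notMem (h : P.Determined K ρ n) : n ∉ K := fun hn => (h.lt_of_mem n hn).false

theorem Determined.of_mem {m : ℕ} (h : P.Determined K ρ m) (hτ : τ ∈ orderClass K ρ) :
    P.Determined K τ m where
  lt_of_mem := h.lt_of_mem
  act_eq π hπ k hk := by
    rw [h.act_eq π (orderClass_eq_of_mem hτ ▸ hπ) k hk, h.act_eq τ hτ k hk]
  acc_eq π hπ k hk := by
    rw [h.acc_eq π (orderClass_eq_of_mem hτ ▸ hπ) k hk, h.acc_eq τ hτ k hk]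
  mem_of_act k hk ha := h.mem_of_act k hk (h.act_eq τ hτ k hk ▸ ha)

theorem Determined.of_decline (h : P.Determined K ρ n)
    (hd : ∀ τ ∈ orderClass K ρ, P.act τ n = false) : P.Determined K ρ (n + 1) where
  lt_of_mem k hk := (h.lt_of_mem k hk).trans (Nat.lt_succ_self _)
  act_eq τ hτ k hk := by
    rcases Nat.lt_succ_iff_lt_or_eq.1 hk with hk | hk
    · exact h.act_eq τ hτ k hk
    · rw [Fin.ext hk, hd τ hτ, hd ρ self_mem_orderClass]
  acc_eq τ hτ k hk := by
    rcases Nat.lt_succ_iff_lt_or_eq.1 hk with hk | hk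
    · exact h.acc_eq τ hτ k hk
    · obtain rfl : k = n := Fin.ext hk
      have hact : ∀ i ≤ k, P.act τ i = P.act ρ i := fun i hi => by
        rcases hi.lt_or_eq with hi | rfl
        · exact h.act_eq τ hτ i hi
        · rw [hd τ hτ, hd ρ self_mem_orderClass]
      have hmem : ∀ i ≤ k, P.act τ i = true → i ∈ K := fun i hi ha => by
        rcases hi.lt_or_eq with hi | rfl
        · exact h.mem_of_act i hi (hact i hi.le ▸ ha)
        · rw [hd τ hτ] at ha; cases ha
      exact P.acc_eq τ ρ k hact fun i j hi hj hai haj =>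
        mem_orderClass.1 hτ i (hmem i hi hai) j (hmem j hj haj)
  mem_of_act k hk ha := by
    rcases Nat.lt_succ_iff_lt_or_eq.1 hk with hk | hk
    · exact h.mem_of_act k hk ha
    · rw [Fin.ext hk, hd ρ self_mem_orderClass] at ha; cases ha

theorem Determined.insert (h : P.Determined K ρ n) :
    P.Determined (Insert.insert n K) ρ (n + 1) := by
  have hsub : orderClass (Insert.insert n K) ρ ⊆ orderClass K ρ :=
    orderClass_anti (Finset.subset_insert n K)
  have hact : ∀ τ ∈ orderClass (Insert.insert n K) ρ, ∀ k ≤ n, P.act τ k = P.act ρ k := by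
    intro τ hτ k hk
    rcases hk.lt_or_eq with hk | rfl
    · exact h.act_eq τ (hsub hτ) k hk
    · have hmem : ∀ i, (i < k ∧ P.act τ i = true ∨ i = k) → i ∈ Insert.insert k K := by
        rintro i (⟨hi, ha⟩ | rfl)
        · exact Finset.mem_insert_of_mem (h.mem_of_act i hi (h.act_eq τ (hsub hτ) i hi ▸ ha))
        · exact Finset.mem_insert_self _ _
      exact P.act_eq τ ρ k (fun i hi => h.act_eq τ (hsub hτ) i hi) fun i j hi hj =>
        mem_orderClass.1 hτ i (hmem i hi) j (hmem j hj)
  have hmem : ∀ k ≤ n, P.act ρ k = true → k ∈ Insert.insert n K := fun k hk ha => by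
    rcases hk.lt_or_eq with hk | rfl
    · exact Finset.mem_insert_of_mem (h.mem_of_act k hk ha)
    · exact Finset.mem_insert_self _ _
  constructor
  · intro k hk
    rcases Finset.mem_insert.1 hk with rfl | hk
    · exact Nat.lt_succ_self _
    · exact (h.lt_of_mem k hk).trans (Nat.lt_succ_self _)
  · exact fun τ hτ k hk => hact τ hτ k (Fin.le_def.2 (Nat.lt_succ_iff.1 hk))
  · intro τ hτ k hk
    have hk' : k ≤ n := Fin.le_def.2 (Nat.lt_succ_iff.1 hk)
    refine P.acc_eq τ ρ k (fun i hi => hact τ hτ i (hi.trans hk')) fun i j hi hj hai haj => ?_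
    rw [hact τ hτ _ (hi.trans hk')] at hai
    rw [hact τ hτ _ (hj.trans hk')] at haj
    exact mem_orderClass.1 hτ i (hmem i (hi.trans hk') hai) j (hmem j (hj.trans hk') haj)
  · exact fun k hk ha => hmem k (Fin.le_def.2 (Nat.lt_succ_iff.1 hk)) ha

/-- If applicant `n` completes under some rank order of the class, then revealing the order of `n`
relative to `K` leaves at most the continuation value of full learning. If applicants better than
all of `K` are accepted with probability at least `c`, this is the dynamic programming equation;
otherwise some finer class of equal size, whose members are worse than the best in `K`, pays the
probability `c` of a wasted acceptance. -/
theorem sum_step_le (hc : c ≤ 1) (h : P.Determined K ρ n)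
    {τ₀ : Equiv.Perm (Fin N)} (hτ₀ : τ₀ ∈ orderClass K ρ) (ha₀ : c ≤ P.acc τ₀ n)
    (hK : K.card < N) :
    ∑ τ ∈ orderClass K ρ, (P.acc τ n * (if ∀ k ∈ K, τ k < τ n then (K.card + 1) / N else 0 : ℝ)
        + (1 - P.acc τ n) * contValue N c (K.card + 1)) ≤
      (orderClass K ρ).card * contValue N c K.card := by
  classical
  set F := contValue N c (K.card + 1)
  set X : ℝ := (K.card + 1) / N
  have hF : 0 ≤ F := contValue_nonneg hc _
  have hX : 0 ≤ X := by positivity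
  have hn := h.notMem
  obtain ⟨ρ', hρ', htop⟩ := exists_orderClass_insert_top hn ρ
  have hacc : ∀ τ ∈ orderClass K ρ, ∀ π ∈ orderClass (Insert.insert n K) τ,
      P.acc π n = P.acc τ n := fun τ hτ π hπ =>
    ((h.of_mem hτ).insert).acc_eq π hπ n (Nat.lt_succ_self _)
  have hmtop : ∀ τ ∈ orderClass K ρ,
      ((∀ k ∈ K, τ k < τ n) ↔ τ ∈ orderClass (Insert.insert n K) ρ') := fun τ hτ => by
    rw [← htop, Finset.mem_filter]; simp [hτ]
  have hacctop : ∀ τ ∈ orderClass (Insert.insert n K) ρ', P.acc τ n = P.acc ρ' n :=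
    hacc ρ' hρ'
  have hacc₀ : ∀ τ ∈ orderClass (Insert.insert n K) τ₀, P.acc τ n = P.acc τ₀ n := hacc τ₀ hτ₀
  set a := P.acc ρ' n
  have ha0 : 0 ≤ a := P.acc_nonneg _ _
  have ha1 : a ≤ 1 := P.acc_le_one _ _
  have hrec : (K.card + 1) * contValue N c K.card = max (c * X + (1 - c) * F) X + K.card * F :=
    contValue_rec hc hK
  set M := max (c * X + (1 - c) * F) X
  have hM1 : c * X + (1 - c) * F ≤ M := le_max_left _ _
  have hM2 : X ≤ M := le_max_right _ _
  have hweak : ∀ τ, (1 - P.acc τ n) * F ≤ F := fun τ => by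
    nlinarith [mul_nonneg (P.acc_nonneg τ n) hF]
  have hsum : ∀ τ₁ ∈ orderClass K ρ, ∀ x : ℝ,
      ∑ τ ∈ orderClass K ρ, (if τ ∈ orderClass (Insert.insert n K) τ₁ then x else 0) =
        (orderClass K ρ).card / (K.card + 1) * x := fun τ₁ hτ₁ x => by
    rw [← Finset.sum_filter, Finset.filter_mem_eq_inter, Finset.inter_eq_right.2
      (orderClass_subset_of_mem (Finset.subset_insert n K) hτ₁), Finset.sum_const, nsmul_eq_mul,
      ← card_orderClass_insert hn ρ τ₁]
    push_cast
    field_simp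
  set C : ℝ := ((orderClass K ρ).card : ℝ)
  have hC : 0 ≤ C := Nat.cast_nonneg _
  have htotal : C * F + C / (K.card + 1) * (M - F) = C * contValue N c K.card := by
    have hΦ : contValue N c K.card = (M + K.card * F) / (K.card + 1) := by
      rw [← hrec]; field_simp
    rw [hΦ]; field_simp; ring
  rw [← htotal]
  have hd : 0 ≤ C / (K.card + 1) := by positivity
  -- if the top position is accepted with probability at least `c`, all others count as rejected
  rcases le_or_gt c a with hca | hca
  · have hpt : ∀ τ ∈ orderClass K ρ, P.acc τ n * (if ∀ k ∈ K, τ k < τ n then X else 0 : ℝ)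
        + (1 - P.acc τ n) * F ≤
        F + if τ ∈ orderClass (Insert.insert n K) ρ' then M - F else 0 := fun τ hτ => by
      simp only [hmtop τ hτ]
      split_ifs with ht
      · rw [hacctop τ ht]
        rcases le_total F X with hFX | hFX <;> nlinarith
      · simpa using hweak τ
    refine (Finset.sum_le_sum hpt).trans_eq ?_
    rw [Finset.sum_add_distrib, hsum ρ' hρ', Finset.sum_const, nsmul_eq_mul]
  -- otherwise the classes of `ρ'` and `τ₀` differ, and the wasted acceptance in the latter counts
  · have hpt : ∀ τ ∈ orderClass K ρ, P.acc τ n * (if ∀ k ∈ K, τ k < τ n then X else 0 : ℝ)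
        + (1 - P.acc τ n) * F ≤
        F + (if τ ∈ orderClass (Insert.insert n K) ρ' then a * X - a * F else 0) +
          (if τ ∈ orderClass (Insert.insert n K) τ₀ then -(c * F) else 0) := fun τ hτ => by
      simp only [hmtop τ hτ]
      split_ifs with ht ht₀ ht₀
      · linarith [hacctop τ ht, hacc₀ τ ht₀]
      · rw [hacctop τ ht]; linarith
      · rw [hacc₀ τ ht₀]; nlinarith
      · simpa using hweak τ
    refine (Finset.sum_le_sum hpt).trans ?_
    rw [Finset.sum_add_distrib, Finset.sum_add_distrib, hsum ρ' hρ', hsum τ₀ hτ₀,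
      Finset.sum_const, nsmul_eq_mul]
    have hloss : a * X - a * F + -(c * F) ≤ M - F := by nlinarith
    linarith [mul_le_mul_of_nonneg_left hloss hd]

/-- Once the first `n` applicants are rejected, the administrator does no better than under full
learning of the abilities of the applicants in `K`. -/
theorem sum_tailSuccess_le (P : OrdinalPlay N c) (hc : c ≤ 1) (j : ℕ) :
    ∀ n : ℕ, n + j = N → ∀ K ρ, P.Determined K ρ n →
      ∑ τ ∈ orderClass K ρ, tailSuccess (P.acc τ) τ n ≤
        reachTo (P.acc ρ) n * ((orderClass K ρ).card * contValue N c K.card) := by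
  induction j with
  | zero =>
    intro n hn K ρ _
    obtain rfl : n = N := hn
    simp only [tailSuccess_self, Finset.sum_const_zero]
    exact mul_nonneg (reachTo_nonneg (P.acc_le_one ρ) _)
      (mul_nonneg (Nat.cast_nonneg _) (contValue_nonneg hc _))
  | succ j ih =>
    intro m hm K ρ h
    obtain ⟨n, rfl⟩ : ∃ n : Fin N, (n : ℕ) = m := ⟨⟨m, by omega⟩, rfl⟩
    have hR0 := reachTo_nonneg (P.acc_le_one ρ) n
    have hreach : ∀ τ ∈ orderClass K ρ, reachTo (P.acc τ) n = reachTo (P.acc ρ) n :=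
      fun τ hτ => reachTo_congr fun k hk => h.acc_eq τ hτ k hk
    rcases hR0.eq_or_lt with hR | hR
    · rw [Finset.sum_eq_zero fun τ hτ => tailSuccess_eq_zero ((hreach τ hτ).trans hR.symm) τ, ← hR,
        zero_mul]
    have hK : K.card < N := by
      have := Finset.card_lt_univ_of_notMem h.notMem
      simpa using this
    have hCpos : (0 : ℝ) < (orderClass K ρ).card := by exact_mod_cast card_orderClass_pos
    by_cases hd : ∀ τ ∈ orderClass K ρ, P.act τ n = false
    -- nothing is learned: applicant `n` is the best overall with probability `1 / N` only
    · have h' := h.of_decline hd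
      have hsucc := ih (n + 1) (by omega) K ρ h'
      have hq : ∀ τ ∈ orderClass K ρ, tailSuccess (P.acc τ) τ n =
          reachTo (P.acc ρ) n * P.acc ρ n * bestInd τ n + tailSuccess (P.acc τ) τ (n + 1) :=
        fun τ hτ => by
          rw [tailSuccess_eq_add, hreach τ hτ, h'.acc_eq τ hτ n (Nat.lt_succ_self _)]
      rw [Finset.sum_congr rfl hq, Finset.sum_add_distrib, ← Finset.mul_sum,
        sum_bestInd_of_notMem h.notMem]
      rw [reachTo_succ] at hsucc
      have hinv := inv_le_contValue hc hK
      have hq0 := P.acc_nonneg ρ n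
      have : reachTo (P.acc ρ) n * P.acc ρ n * ((orderClass K ρ).card * (1 / N)) ≤
          reachTo (P.acc ρ) n * P.acc ρ n * ((orderClass K ρ).card * contValue N c K.card) := by
        gcongr
      rw [mul_one_div] at this
      linarith
    · push Not at hd
      obtain ⟨τ₀, hτ₀, ha⟩ := hd
      have ha₀ : c ≤ P.acc τ₀ n :=
        P.le_acc τ₀ n (by rw [hreach τ₀ hτ₀]; exact hR) (by simpa using ha)
      have hins : ∀ τ ∈ orderClass K ρ, P.Determined (Insert.insert n K) τ (n + 1) :=
        fun τ hτ => (h.of_mem hτ).insert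
      have hsplit := sum_tailSuccess_insert h.notMem ρ P.acc fun τ hτ π hπ k hk =>
        (hins τ hτ).acc_eq π hπ k (Nat.lt_succ_iff.2 (Fin.le_def.1 hk))
      have hd0 : (0 : ℝ) < (orderClass K ρ).card / (K.card + 1) := by positivity
      refine le_of_mul_le_mul_left (hsplit.trans_le ?_) hd0
      have hstep := sum_step_le hc h hτ₀ ha₀ hK
      calc _ ≤ ∑ τ ∈ orderClass K ρ, ((orderClass K ρ).card / (K.card + 1) : ℝ) *
            (reachTo (P.acc ρ) n *
              (P.acc τ n * (if ∀ k ∈ K, τ k < τ n then (K.card + 1) / N else 0 : ℝ)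
                + (1 - P.acc τ n) * contValue N c (K.card + 1))) := by
            refine Finset.sum_le_sum fun τ hτ => ?_
            have h1 := ih (n + 1) (by omega) _ τ (hins τ hτ)
            rw [reachTo_succ, hreach τ hτ, Finset.card_insert_of_notMem h.notMem] at h1
            have h2 : ((orderClass (Insert.insert n K) τ).card : ℝ) =
                (orderClass K ρ).card / (K.card + 1) := by
              rw [← card_orderClass_insert h.notMem ρ τ]; push_cast; field_simp
            rw [h2] at h1
            rw [hreach τ hτ]
            refine (add_le_add_right h1 _).trans_eq ?_
            split_ifs <;> ring
        _ ≤ _ := by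
            rw [← Finset.mul_sum, ← Finset.mul_sum]
            gcongr

/-- The success probability of ordinal play is at most the value of full learning. -/
theorem sum_success_le (P : OrdinalPlay N c) (hc : c ≤ 1) :
    ∑ τ, ∑ m : Fin N, reachTo (P.acc τ) m * P.acc τ m * bestInd τ m ≤
      N.factorial * fullLearningValue N c := by
  have h := P.sum_tailSuccess_le hc N 0 (zero_add N) ∅ 1
    ⟨by simp, by simp, by simp, by simp⟩
  have huniv : orderClass (∅ : Finset (Fin N)) 1 = Finset.univ := by simp [orderClass]
  simpa [tailSuccess_zero, reachTo_zero, huniv, contValue, Fintype.card_perm] using h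

end OrdinalPlay

/-! ### Policies that accept only the best applicant so far -/

section RecordPolicy

variable {N : ℕ}

/-- Acceptance probability, under the rank order `τ`, of the policy that accepts applicant `k` with
probability `p k` if better than all predecessors, and rejects `k` otherwise. -/
def recordAcc (p : Fin N → ℝ) (τ : Equiv.Perm (Fin N)) (k : Fin N) : ℝ :=
  if ∀ i < k, τ i < τ k then p k else 0

theorem recordAcc_congr {p : Fin N → ℝ} {τ π : Equiv.Perm (Fin N)} {K : Finset (Fin N)}
    (h : τ ∈ orderClass K π) {k : Fin N} (hK : ∀ i ≤ k, i ∈ K) :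
    recordAcc p τ k = recordAcc p π k := by
  unfold recordAcc
  refine if_congr (forall₂_congr fun i hi => ?_) rfl rfl
  exact mem_orderClass.1 h i (hK i hi.le) k (hK k le_rfl)

/-- In the class of rank orders with a prescribed order of the first `n` applicants, the policy
succeeds after rejecting them with average probability `W n`. -/
theorem sum_tailSuccess_recordAcc (p : Fin N → ℝ) (W : ℕ → ℝ) (hW0 : W N = 0)
    (hW : ∀ n : Fin N, (n + 1) * W n =
      p n * ((n + 1) / N) + (1 - p n) * W (n + 1) + n * W (n + 1)) (j : ℕ) :
    ∀ n : ℕ, n + j = N → ∀ ρ : Equiv.Perm (Fin N),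
      ∑ τ ∈ orderClass (Finset.univ.filter fun k : Fin N => (k : ℕ) < n) ρ,
          tailSuccess (recordAcc p τ) τ n =
        reachTo (recordAcc p ρ) n *
          ((orderClass (Finset.univ.filter fun k : Fin N => (k : ℕ) < n) ρ).card * W n) := by
  induction j with
  | zero =>
    intro n hn ρ
    obtain rfl : n = N := hn
    simp only [tailSuccess_self, Finset.sum_const_zero, hW0, mul_zero]
  | succ j ih =>
    intro m hm ρ
    obtain ⟨n, rfl⟩ : ∃ n : Fin N, (n : ℕ) = m := ⟨⟨m, by omega⟩, rfl⟩
    have ih' := ih (n + 1) (by omega)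
    have hins : (Finset.univ.filter fun k : Fin N => (k : ℕ) < n + 1) =
        insert n (Finset.univ.filter fun k : Fin N => (k : ℕ) < n) := by
      ext k
      simp only [Finset.mem_filter, Finset.mem_univ, true_and, Finset.mem_insert, Fin.ext_iff]
      omega
    rw [hins] at ih'
    set K := Finset.univ.filter fun k : Fin N => (k : ℕ) < n with hKdef
    have hmem : ∀ k, k ∈ K ↔ k < n := fun k => by
      rw [hKdef, Finset.mem_filter, Fin.lt_def]; simp only [Finset.mem_univ, true_and]
    have hn : n ∉ K := by simp [hmem]
    have hcard : K.card = n := by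
      rw [show K = Finset.Iio n by ext; simp [hmem], Fin.card_Iio]
    have hreach : ∀ τ ∈ orderClass K ρ, reachTo (recordAcc p τ) n = reachTo (recordAcc p ρ) n :=
      fun τ hτ => reachTo_congr fun k hk => recordAcc_congr hτ fun i hi =>
        (hmem i).2 (hi.trans_lt (Fin.lt_def.2 hk))
    have hsplit := sum_tailSuccess_insert hn ρ (recordAcc p) fun τ hτ π hπ k hk =>
      recordAcc_congr hπ fun i hi => by
        rw [Finset.mem_insert, hmem, ← le_iff_eq_or_lt]; exact hi.trans hk
    have hCpos : (0 : ℝ) < (orderClass K ρ).card := by exact_mod_cast card_orderClass_pos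
    set C : ℝ := ((orderClass K ρ).card : ℝ)
    rw [hcard] at hsplit
    have hterm : ∀ τ ∈ orderClass K ρ,
        (reachTo (recordAcc p τ) n * recordAcc p τ n *
            (if ∀ k ∈ K, τ k < τ n then (C / (n + 1) : ℝ) * ((n + 1) / N) else 0) +
          ∑ π ∈ orderClass (insert n K) τ, tailSuccess (recordAcc p π) π (n + 1)) =
        C / (n + 1) * reachTo (recordAcc p ρ) n *
          (W (n + 1) + if ∀ k ∈ K, τ k < τ n then p n * ((n + 1) / N) - p n * W (n + 1) else 0) :=
      fun τ hτ => by
        have h2 : ((orderClass (insert n K) τ).card : ℝ) = C / (n + 1) := by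
          have := card_orderClass_insert hn ρ τ
          rw [hcard] at this
          rw [eq_div_iff (by positivity), ← Nat.cast_add_one, ← Nat.cast_mul, this]
        rw [ih' τ, reachTo_succ, hreach τ hτ, h2]
        have hrec : recordAcc p τ n = if ∀ k ∈ K, τ k < τ n then p n else 0 := by
          simp only [recordAcc, hmem]
        rw [hrec]
        split_ifs <;> ring
    rw [Finset.sum_congr rfl hterm, ← Finset.mul_sum, Finset.sum_add_distrib, Finset.sum_const,
      ← Finset.sum_filter, Finset.sum_const, nsmul_eq_mul, nsmul_eq_mul] at hsplit
    have htop : (((orderClass K ρ).filter (fun τ => ∀ k ∈ K, τ k < τ n)).card : ℝ) =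
        C / (n + 1) := by
      have := card_filter_top hn ρ
      rw [hcard] at this
      rw [eq_div_iff (by positivity), ← Nat.cast_add_one, ← Nat.cast_mul, this]
    rw [htop, mul_assoc] at hsplit
    have hne : C / ((n : ℝ) + 1) ≠ 0 := by positivity
    rw [mul_left_cancel₀ hne hsplit]
    have hWn : W n = (p n * ((n + 1) / N) + (1 - p n) * W (n + 1) + n * W (n + 1)) / (n + 1) := by
      rw [← hW n]; field_simp
    rw [hWn]
    change _ * (C * _ + _) = _ * (C * _)
    field_simp
    ring

/-- The success probability of a policy that accepts only the best applicant so far solves the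
dynamic programming equation of that policy. -/
theorem sum_success_recordAcc (p : Fin N → ℝ) (W : ℕ → ℝ) (hW0 : W N = 0)
    (hW : ∀ n : Fin N, (n + 1) * W n =
      p n * ((n + 1) / N) + (1 - p n) * W (n + 1) + n * W (n + 1)) :
    ∑ τ, ∑ m : Fin N, reachTo (recordAcc p τ) m * recordAcc p τ m * bestInd τ m =
      N.factorial * W 0 := by
  have h := sum_tailSuccess_recordAcc p W hW0 hW N 0 (zero_add N) 1
  have huniv : orderClass (Finset.univ.filter fun k : Fin N => (k : ℕ) < 0) 1 = Finset.univ := by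
    simp [orderClass]
  simpa only [huniv, tailSuccess_zero, reachTo_zero, one_mul, Finset.card_univ, Fintype.card_perm,
    Fintype.card_fin] using h

/-- The solution of the dynamic programming equation of the policy `p`, indexed by the number of
remaining applicants. -/
noncomputable def policyValue (N : ℕ) (p : ℕ → ℝ) : ℕ → ℝ
  | 0 => 0
  | j + 1 =>
    (p (N - (j + 1)) * (((N - (j + 1) : ℕ) + 1) / N)
      + (1 - p (N - (j + 1))) * policyValue N p j
      + (N - (j + 1) : ℕ) * policyValue N p j) / ((N - (j + 1) : ℕ) + 1)

theorem policyValue_rec (p : ℕ → ℝ) (n : Fin N) :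
    (n + 1) * policyValue N p (N - n) = p n * ((n + 1) / N)
      + (1 - p n) * policyValue N p (N - (n + 1)) + n * policyValue N p (N - (n + 1)) := by
  obtain ⟨j, hj⟩ : ∃ j, N - n = j + 1 := ⟨N - n - 1, by omega⟩
  have h1 : N - (n + 1) = j := by omega
  have h2 : N - (j + 1) = n := by omega
  rw [h1, hj, policyValue, h2]
  field_simp

theorem continuous_policyValue {X : Type*} [TopologicalSpace X] {p : X → ℕ → ℝ}
    (hp : ∀ n, Continuous fun x => p x n) (j : ℕ) :
    Continuous fun x => policyValue N (p x) j := by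
  induction j with
  | zero => simpa [policyValue] using continuous_const
  | succ j ih =>
    have := hp (N - (j + 1))
    simp only [policyValue]
    fun_prop

/-- A function that solves the dynamic programming equation of the policy `p` is its value. -/
theorem policyValue_eq {p : ℕ → ℝ} {W : ℕ → ℝ} (hW0 : W N = 0)
    (hW : ∀ n < N, ((n : ℝ) + 1) * W n =
      p n * ((n + 1) / N) + (1 - p n) * W (n + 1) + n * W (n + 1)) {j : ℕ} (hj : j ≤ N) :
    policyValue N p j = W (N - j) := by
  induction j with
  | zero => simp [policyValue, hW0]
  | succ j ih =>
    have h1 : N - (j + 1) + 1 = N - j := by omega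
    have h := hW (N - (j + 1)) (by omega)
    rw [h1] at h
    rw [policyValue, ih (by omega), ← h]
    field_simp

end RecordPolicy

/-! ### Optimality of the threshold -/

section Threshold

variable {N : ℕ} {c : ℝ}

theorem sum_Ico_inv_eq_add {n : ℕ} (hn : n < N) :
    ∑ k ∈ Finset.Ico n N, (1 : ℝ) / k = 1 / n + ∑ k ∈ Finset.Ico (n + 1) N, (1 : ℝ) / k :=
  Finset.sum_eq_sum_Ico_succ_bot hn _

theorem le_contValue (hc : c ≤ 1) (hN : 0 < N) {n : ℕ} (h0 : 0 < n) (hn : n ≤ N) :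
    n / N * ∑ k ∈ Finset.Ico n N, (1 : ℝ) / k ≤ contValue N c n := by
  induction hn using Nat.decreasingInduction with
  | self => simp [contValue_self hN]
  | of_succ n hn ih =>
    have hrec := contValue_rec hc hn
    have hmax := le_max_right (c * ((n + 1) / N) + (1 - c) * contValue N c (n + 1))
      ((n + 1) / N : ℝ)
    have ih' := mul_le_mul_of_nonneg_left (ih (Nat.succ_pos n)) (Nat.cast_nonneg (α := ℝ) n)
    rw [sum_Ico_inv_eq_add hn]
    push_cast at ih'
    have hn0 : (n : ℝ) ≠ 0 := by exact_mod_cast h0.ne'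
    have hN0 : (N : ℝ) ≠ 0 := by exact_mod_cast hN.ne'
    refine le_of_mul_le_mul_left (a := (n : ℝ) + 1) ?_ (by positivity)
    rw [hrec]
    have e : ((n : ℝ) + 1) * (n / N * (1 / n + ∑ k ∈ Finset.Ico (n + 1) N, (1 : ℝ) / k)) =
        (n + 1) / N + n * ((n + 1) / N * ∑ k ∈ Finset.Ico (n + 1) N, (1 : ℝ) / k) := by
      field_simp
    rw [e]
    linarith

theorem contValue_le (hc : c ≤ 1) (hN : 0 < N) {n : ℕ} (h0 : 0 < n) (hn : n ≤ N)
    (hs : ∑ k ∈ Finset.Ico n N, (1 : ℝ) / k ≤ 1) :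
    contValue N c n ≤ n / N * ∑ k ∈ Finset.Ico n N, (1 : ℝ) / k := by
  induction hn using Nat.decreasingInduction with
  | self => simp [contValue_self hN]
  | of_succ n hn ih =>
    have hrec := contValue_rec hc hn
    rw [sum_Ico_inv_eq_add hn] at hs ⊢
    have hs' : ∑ k ∈ Finset.Ico (n + 1) N, (1 : ℝ) / k ≤ 1 := by
      have : (0 : ℝ) ≤ 1 / n := by positivity
      linarith
    have ih1 := ih (Nat.succ_pos n) hs'
    push_cast at ih1
    have hF : contValue N c (n + 1) ≤ (n + 1) / N :=
      ih1.trans (mul_le_of_le_one_right (by positivity) hs')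
    have hmax : max (c * ((n + 1) / N) + (1 - c) * contValue N c (n + 1)) ((n + 1) / N : ℝ) =
        (n + 1) / N := max_eq_right (by nlinarith)
    rw [hmax] at hrec
    have ih' := mul_le_mul_of_nonneg_left ih1 (Nat.cast_nonneg (α := ℝ) n)
    have hn0 : (n : ℝ) ≠ 0 := by exact_mod_cast h0.ne'
    have hN0 : (N : ℝ) ≠ 0 := by exact_mod_cast hN.ne'
    refine le_of_mul_le_mul_left (a := (n : ℝ) + 1) ?_ (by positivity)
    rw [hrec]
    have e : ((n : ℝ) + 1) * (n / N * (1 / n + ∑ k ∈ Finset.Ico (n + 1) N, (1 : ℝ) / k)) =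
        (n + 1) / N + n * ((n + 1) / N * ∑ k ∈ Finset.Ico (n + 1) N, (1 : ℝ) / k) := by
      field_simp
    rw [e]
    linarith

theorem threshold_mem (hN : 0 < N) :
    1 ≤ threshold N ∧ ∑ k ∈ Finset.Ico (threshold N) N, (1 : ℝ) / k ≤ 1 :=
  Nat.sInf_mem (s := {n : ℕ | 1 ≤ n ∧ ∑ k ∈ Finset.Ico n N, (1 : ℝ) / (k : ℝ) ≤ 1})
    ⟨N, hN, by simp⟩

theorem sum_Ico_inv_le_one (hN : 0 < N) {n : ℕ} (h : threshold N ≤ n) :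
    ∑ k ∈ Finset.Ico n N, (1 : ℝ) / k ≤ 1 :=
  (Finset.sum_le_sum_of_subset_of_nonneg (Finset.Ico_subset_Ico_left h)
    fun _ _ _ => by positivity).trans (threshold_mem hN).2

theorem one_lt_sum_Ico_inv {n : ℕ} (h0 : 1 ≤ n) (h : n < threshold N) :
    1 < ∑ k ∈ Finset.Ico n N, (1 : ℝ) / k := by
  by_contra hle
  exact Nat.notMem_of_lt_sInf h ⟨h0, not_lt.1 hle⟩

/-- The threshold policy attains the maximum in the dynamic programming equation: accepting the best
applicant so far is better than continuing exactly from the threshold on. -/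
theorem contValue_rec_threshold (hc : c ≤ 1) (n : ℕ) (hn : n < N) :
    ((n : ℝ) + 1) * contValue N c n =
      (if threshold N ≤ n + 1 then 1 else c) * ((n + 1) / N)
        + (1 - if threshold N ≤ n + 1 then 1 else c) * contValue N c (n + 1)
        + n * contValue N c (n + 1) := by
  have hN : 0 < N := by omega
  rw [contValue_rec hc hn]
  congr 1
  split_ifs with h
  · have hs := sum_Ico_inv_le_one hN h
    have h1 := contValue_le hc hN (Nat.succ_pos n) hn hs
    push_cast at h1
    have hF : contValue N c (n + 1) ≤ (n + 1) / N :=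
      h1.trans (mul_le_of_le_one_right (by positivity) hs)
    rw [max_eq_right (by nlinarith)]
    ring
  · have hs := one_lt_sum_Ico_inv (Nat.succ_pos n) (not_le.1 h)
    have h1 := le_contValue (c := c) hc hN (Nat.succ_pos n) hn
    push_cast at h1
    have hF : ((n : ℝ) + 1) / N ≤ contValue N c (n + 1) :=
      (le_mul_of_one_le_right (by positivity) hs.le).trans h1
    rw [max_eq_left (by nlinarith)]

/-- The value of the threshold policy. -/
theorem policyValue_threshold (hc : c ≤ 1) (hN : 0 < N) :
    policyValue N (fun n => if threshold N ≤ n + 1 then 1 else c) N = fullLearningValue N c := by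
  rw [policyValue_eq (contValue_self hN) (fun n hn => contValue_rec_threshold hc n hn) le_rfl]
  simp [contValue]

end Threshold

/-! ### Ramsey's theorem and order-invariance -/

section Ramsey

/-- Infinite Ramsey theorem: for a finite colouring of the `k`-element sets of natural numbers there
is an infinite set all of whose `k`-element subsets have the same colour. -/
theorem exists_orderEmbedding_monochromatic {C : Type*} [Finite C] (k : ℕ) :
    ∀ f : Finset ℕ → C, ∃ (e : ℕ ↪o ℕ) (c : C), ∀ S : Finset ℕ, S.card = k →
      f (S.map e.toEmbedding) = c := by
  induction k with
  | zero =>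
    refine fun f => ⟨RelEmbedding.refl _, f ∅, fun S hS => ?_⟩
    rw [Finset.card_eq_zero.1 hS, Finset.map_empty]
  | succ k ih =>
    intro f
    -- thin out `g` such that the colour of a set with least element `g 0` is always the same
    have hnext : ∀ g : ℕ ↪o ℕ, ∃ (h : ℕ ↪o ℕ) (c : C), (∀ i, ∃ j, h i = g (j + 1)) ∧
        ∀ S : Finset ℕ, S.card = k → f (insert (g 0) (S.map h.toEmbedding)) = c := by
      intro g
      let g' : ℕ ↪o ℕ := OrderEmbedding.ofStrictMono (fun i => g (i + 1)) fun i j hij =>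
        g.lt_iff_lt.2 (Nat.succ_lt_succ hij)
      obtain ⟨h, c, hc⟩ := ih fun S => f (insert (g 0) (S.map g'.toEmbedding))
      refine ⟨h.trans g', c, fun i => ⟨h i, rfl⟩, fun S hS => ?_⟩
      rw [← hc S hS, Finset.map_map]
      rfl
    choose next col hrange hcol using hnext
    let g : ℕ → (ℕ ↪o ℕ) := fun i => next^[i] (RelEmbedding.refl _)
    have hg : ∀ i, g (i + 1) = next (g i) := fun i => Function.iterate_succ_apply' _ _ _
    have hsub : ∀ i d, ∀ x, ∃ y, g (i + d) x = g i y := by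
      intro i d
      induction d with
      | zero => exact fun x => ⟨x, rfl⟩
      | succ d ihd =>
        intro x
        obtain ⟨j, hj⟩ := hrange (g (i + d)) x
        obtain ⟨y, hy⟩ := ihd (j + 1)
        exact ⟨y, by rw [← add_assoc, hg, hj, hy]⟩
    have hmem : ∀ {i j}, i < j → ∃ y, g j 0 = g (i + 1) y := fun {i j} hij => by
      obtain ⟨d, rfl⟩ := Nat.exists_eq_add_of_lt hij
      have := hsub (i + 1) d 0
      rwa [show i + 1 + d = i + d + 1 by ring] at this
    have hmono : StrictMono fun i => g i 0 := by
      refine strictMono_nat_of_lt_succ fun i => ?_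
      obtain ⟨j, hj⟩ := hrange (g i) 0
      rw [hg, hj]
      exact (g i).lt_iff_lt.2 (Nat.succ_pos j)
    obtain ⟨c, hc⟩ := Finite.exists_infinite_fiber fun i => col (g i)
    classical
    -- the least elements `g i 0` with a colour that occurs infinitely often form the required set
    let I := Nat.orderEmbeddingOfSet ((fun i => col (g i)) ⁻¹' {c})
    have hI : ∀ i, col (g (I i)) = c := fun i => by
      have : I i ∈ (fun i => col (g i)) ⁻¹' {c} := by
        rw [← Nat.orderEmbeddingOfSet_range ((fun i => col (g i)) ⁻¹' {c})]
        exact ⟨i, rfl⟩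
      exact this
    let e : ℕ ↪o ℕ := I.trans (OrderEmbedding.ofStrictMono _ hmono)
    refine ⟨e, c, fun S hS => ?_⟩
    have hne : S.Nonempty := Finset.card_pos.1 (by omega)
    set m := S.min' hne
    have hmS : m ∈ S := S.min'_mem hne
    have hall : ∀ i ∈ S.erase m, ∃ y, e i = g (I m + 1) y := fun i hi => by
      refine hmem (I.lt_iff_lt.2 ?_)
      exact lt_of_le_of_ne (S.min'_le i (Finset.mem_of_mem_erase hi))
        (Finset.ne_of_mem_erase hi).symm
    choose! y hy using hall
    have hyinj : Set.InjOn y (S.erase m) := fun i hi j hj hij => by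
      apply e.injective
      rw [hy i hi, hy j hj, hij]
    have hcard : ((S.erase m).image y).card = k := by
      rw [Finset.card_image_of_injOn hyinj, Finset.card_erase_of_mem hmS, hS, Nat.add_sub_cancel]
    rw [← hI m, ← hcol (g (I m)) _ hcard, ← hg]
    congr 1
    rw [← Finset.insert_erase hmS, Finset.map_insert]
    congr 1
    rw [Finset.erase_insert_eq_erase, Finset.erase_eq_of_notMem (Finset.notMem_erase m S)]
    ext x
    simp only [Finset.mem_map, Finset.mem_image, exists_exists_and_eq_and]
    exact exists_congr fun i => and_congr_right fun hi => by
      change e i = x ↔ g (I m + 1) (y i) = x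
      rw [hy i hi]

/-- Ramsey's theorem for the sets of each size below `M` simultaneously. -/
theorem exists_orderEmbedding_forall_monochromatic {C : Type*} [Finite C] (f : Finset ℕ → C)
    (M : ℕ) : ∃ e : ℕ ↪o ℕ, ∀ k < M, ∃ c, ∀ S : Finset ℕ, S.card = k →
      f (S.map e.toEmbedding) = c := by
  induction M with
  | zero => exact ⟨RelEmbedding.refl _, by simp⟩
  | succ M ih =>
    obtain ⟨e, he⟩ := ih
    obtain ⟨h, c, hc⟩ := exists_orderEmbedding_monochromatic M fun S => f (S.map e.toEmbedding)
    refine ⟨h.trans e, fun k hk => ?_⟩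
    have hmap : ∀ S : Finset ℕ, S.map (h.trans e).toEmbedding =
        (S.map h.toEmbedding).map e.toEmbedding := fun S => by
      rw [Finset.map_map]; rfl
    rcases Nat.lt_succ_iff_lt_or_eq.1 hk with hk | rfl
    · obtain ⟨c', hc'⟩ := he k hk
      exact ⟨c', fun S hS => by rw [hmap]; exact hc' _ (by simpa using hS)⟩
    · exact ⟨c, fun S hS => by rw [hmap]; exact hc S hS⟩

theorem card_image_eq_of_lt_iff {ι : Type*} {x x' : ι → ℕ} {B : Finset ι}
    (h : ∀ a ∈ B, ∀ b ∈ B, (x a < x b ↔ x' a < x' b)) :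
    (B.image x).card = (B.image x').card := by
  have key : ∀ {x x' : ι → ℕ}, (∀ a ∈ B, ∀ b ∈ B, (x a < x b ↔ x' a < x' b)) →
      (B.image x').card ≤ (B.image x).card := by
    intro x x' h
    obtain ⟨g, hg⟩ : ∃ g : ℕ → ℕ, ∀ a ∈ B, g (x a) = x' a := by
      classical
      refine ⟨fun v => if hv : ∃ a ∈ B, x a = v then x' hv.choose else 0, fun a ha => ?_⟩
      have hv : ∃ b ∈ B, x b = x a := ⟨a, ha, rfl⟩
      simp only [dif_pos hv]
      obtain ⟨h1, h2⟩ := hv.choose_spec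
      have h3 := h _ h1 a ha
      have h4 := h a ha _ h1
      omega
    have : B.image x' = (B.image x).image g := by
      rw [Finset.image_image]
      exact Finset.image_congr fun a ha => (hg a ha).symm
    rw [this]
    exact Finset.card_image_le
  exact le_antisymm (key fun a ha b hb => (h a ha b hb).symm) (key h)

/-- Finitely many finite-valued functions of tuples become order-invariant on an infinite set. Only
the coordinates `a` with `Z a = true` are relevant. -/
theorem exists_orderEmbedding_invariant {ι C : Type*} [Finite ι] [Finite C] (m : ι → ℕ)
    (G : (i : ι) → (Fin (m i) → Bool) → (Fin (m i) → ℕ) → C)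
    (hG : ∀ i Z x x', (∀ a, Z a = true → x a = x' a) → G i Z x = G i Z x') :
    ∃ e : ℕ ↪o ℕ, ∀ (i : ι) (Z : Fin (m i) → Bool) (x x' : Fin (m i) → ℕ),
      (∀ a b, Z a = true → Z b = true → (x a < x b ↔ x' a < x' b)) →
        G i Z (fun a => e (x a)) = G i Z (fun a => e (x' a)) := by
  classical
  obtain ⟨M, hM⟩ : ∃ M, ∀ i, m i ≤ M := by
    obtain ⟨M, hM⟩ := (Set.finite_range m).bddAbove
    exact ⟨M, fun i => hM ⟨i, rfl⟩⟩
  -- the colour of `S` records the values of `G` at all tuples with entries in `S`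
  let f : Finset ℕ → (i : ι) → (Fin (m i) → Bool) → (Fin (m i) → Fin (M + 1)) → C :=
    fun S i Z u => G i Z fun a => Nat.nth (· ∈ S) (u a)
  obtain ⟨e, he⟩ := exists_orderEmbedding_forall_monochromatic f (M + 1)
  refine ⟨e, fun i Z x x' h => ?_⟩
  let T : Finset (Fin (m i)) := Finset.univ.filter fun a => Z a = true
  have hT : ∀ {a}, a ∈ T ↔ Z a = true := fun {a} => by simp [T]
  have hle : ∀ B : Finset (Fin (m i)), ∀ x : Fin (m i) → ℕ, (B.image x).card < M + 1 := fun B x =>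
    Nat.lt_succ_of_le (Finset.card_image_le.trans (by
      have := B.card_le_univ
      simp only [Fintype.card_fin] at this
      exact this.trans (hM i)))
  -- the rank of an entry among the relevant ones, counted without multiplicity
  let r : (Fin (m i) → ℕ) → Fin (m i) → Fin (M + 1) := fun x a =>
    if Z a = true then ⟨((T.filter fun b => x b < x a).image x).card, hle _ _⟩ else 0
  have key : ∀ x : Fin (m i) → ℕ,
      G i Z (fun a => e (x a)) = f ((T.image x).map e.toEmbedding) i Z (r x) := by
    intro x
    refine hG i Z _ _ fun a ha => ?_
    set S := (T.image x).map e.toEmbedding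
    have haS : e (x a) ∈ S :=
      Finset.mem_map_of_mem e.toEmbedding (Finset.mem_image_of_mem x (hT.2 ha))
    have hcount : Nat.count (· ∈ S) (e (x a)) = (r x a : ℕ) := by
      simp only [r, if_pos ha]
      rw [Nat.count_eq_card_filter_range]
      have : (Finset.range (e (x a))).filter (· ∈ S) =
          ((T.filter fun b => x b < x a).image x).map e.toEmbedding := by
        ext v
        simp only [S, Finset.mem_filter, Finset.mem_range, Finset.mem_map, Finset.mem_image]
        constructor
        · rintro ⟨hv, _, ⟨b, hb, rfl⟩, rfl⟩
          exact ⟨x b, ⟨b, ⟨hb, e.lt_iff_lt.1 hv⟩, rfl⟩, rfl⟩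
        · rintro ⟨_, ⟨b, ⟨hb, hlt⟩, rfl⟩, rfl⟩
          exact ⟨e.lt_iff_lt.2 hlt, x b, ⟨b, hb, rfl⟩, rfl⟩
      rw [this, Finset.card_map]
    rw [← hcount, Nat.nth_count haS]
  have hr : r x = r x' := by
    funext a
    by_cases ha : Z a = true
    · apply Fin.ext
      have hfil : (T.filter fun b => x b < x a) = T.filter fun b => x' b < x' a :=
        Finset.filter_congr fun b hb => h b a (hT.1 hb) ha
      simp only [r, if_pos ha]
      rw [← hfil]
      exact card_image_eq_of_lt_iff fun b hb b' hb' =>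
        h b b' (hT.1 (Finset.mem_filter.1 hb).1) (hT.1 (Finset.mem_filter.1 hb').1)
    · simp only [r, if_neg ha]
  obtain ⟨c, hc⟩ := he _ (hle T x)
  rw [key x, key x', hr, hc _ rfl, hc _ (card_image_eq_of_lt_iff fun a ha b hb =>
    h a b (hT.1 ha) (hT.1 hb)).symm]

end Ramsey

/-! ### Play along a rank order -/

section Play

variable {N : ℕ} (σ : AdminStrategy N) (s : ApplicantStrategy N) (θ : Fin N → Ability)

/-- The action of applicant `n` in play when the abilities are `θ`. -/
def playedAction (n : Fin N) : Bool := s σ n (history σ s θ n) (θ n)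

theorem output_eq (n : Fin N) : output σ s θ n = outputOf (playedAction σ s θ n) (θ n) := by
  rw [output]; rfl

theorem acceptProb_nonneg (n : Fin N) : 0 ≤ acceptProb σ s θ n := (σ n _).2.1

theorem acceptProb_le_one (n : Fin N) : acceptProb σ s θ n ≤ 1 := (σ n _).2.2

theorem acceptProb_eq (n : Fin N) : acceptProb σ s θ n =
    σ n (Fin.snoc (α := fun _ => ℝ≥0) (history σ s θ n)
      (outputOf (s σ n (history σ s θ n) (θ n)) (θ n))) := by
  rw [acceptProb, output_eq]; rfl

theorem snoc_history_output (n : Fin N) :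
    (Fin.snoc (α := fun _ => ℝ≥0) (history σ s θ n) (output σ s θ n) : Fin (n + 1) → ℝ≥0) =
      fun a => output σ s θ (Fin.castLE n.2 a) := by
  funext a
  refine Fin.lastCases ?_ (fun a => ?_) a
  · simp only [Fin.snoc_last]; rfl
  · simp only [Fin.snoc_castSucc]; rfl

theorem reachProb_eq (n : Fin N) : reachProb σ s θ n = reachTo (acceptProb σ s θ) n := by
  rw [reachProb, reachTo]
  refine Finset.prod_congr (Finset.ext fun k => ?_) fun _ _ => rfl
  rw [Finset.mem_Iio, Finset.mem_filter, Fin.lt_def]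
  simp only [Finset.mem_univ, true_and]

theorem reachProb_nonneg (n : Fin N) : 0 ≤ reachProb σ s θ n :=
  reachProb_eq σ s θ n ▸ reachTo_nonneg (acceptProb_le_one σ s θ) n

theorem successGiven_nonneg : 0 ≤ successGiven σ s θ :=
  Finset.sum_nonneg fun n _ => mul_nonneg
    (mul_nonneg (reachProb_nonneg σ s θ n) (acceptProb_nonneg σ s θ n))
    (by split_ifs <;> norm_num)

theorem successProbAt_nonneg (w : Fin N ↪ Ability) : 0 ≤ successProbAt σ s w :=
  div_nonneg (Finset.sum_nonneg fun _ _ => successGiven_nonneg σ s _) (Nat.cast_nonneg _)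

theorem bddBelow_successProbAt :
    BddBelow (Set.range fun w : Fin N ↪ Ability => successProbAt σ s w) :=
  ⟨0, by rintro _ ⟨w, rfl⟩; exact successProbAt_nonneg σ s w⟩

theorem successGiven_eq {w : Fin N → Ability} (hw : StrictMono w) (τ : Equiv.Perm (Fin N)) :
    successGiven σ s (fun n => w (τ n)) = ∑ m : Fin N,
      reachTo (acceptProb σ s fun n => w (τ n)) m * acceptProb σ s (fun n => w (τ n)) m *
        bestInd τ m := by
  refine Finset.sum_congr rfl fun m _ => ?_
  simp only [reachProb_eq, bestInd, hw.le_iff_le]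

/-- In a random order it does not matter in which order a set of values is listed. -/
theorem exists_strictMono_successProbAt_eq (w : Fin N ↪ Ability) :
    ∃ w' : Fin N → Ability, StrictMono w' ∧ ∀ s : ApplicantStrategy N, ∀ σ : AdminStrategy N,
      successProbAt σ s w =
        (∑ τ : Equiv.Perm (Fin N), successGiven σ s fun n => w' (τ n)) / N.factorial := by
  refine ⟨w ∘ Tuple.sort w, (Tuple.monotone_sort w).strictMono_of_injective
    (w.injective.comp (Tuple.sort w).injective), fun s σ => ?_⟩
  rw [successProbAt, ← Equiv.sum_comp (Equiv.mulLeft (Tuple.sort w)) (fun τ : Equiv.Perm (Fin N) =>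
    successGiven σ s fun n => w (τ n))]
  rfl

end Play

/-! ### The bound for every profile with best responding applicants -/

section UpperBound

/-- A strictly increasing sequence of abilities. -/
def abilitySeq (m : ℕ) : Ability := ⟨(m : ℝ≥0) + 1, by
  simp only [Set.mem_Ioi]; positivity⟩

theorem strictMono_abilitySeq : StrictMono abilitySeq := fun i j hij => by
  change (i : ℝ≥0) + 1 < j + 1
  gcongr

/-- The grid cell of a probability: the rounded down multiple of `1 / K`, and whether the
probability is at least `c`. -/
noncomputable def gridCell (c : ℝ) (K : ℕ) (p : unitInterval) : Bool × Fin (K + 1) :=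
  open scoped Classical in
  (decide (c ≤ p), ⟨⌊(K : ℝ) * p⌋₊, Nat.lt_succ_of_le <| Nat.floor_le_of_le <|
    mul_le_of_le_one_right (Nat.cast_nonneg K) p.2.2⟩)

/-- The representative of a grid cell. It is below all members of the cell but not below `c` unless
they are. -/
noncomputable def gridValue (c : ℝ) (K : ℕ) (g : Bool × Fin (K + 1)) : ℝ :=
  if g.1 = true then max c (g.2 / K) else g.2 / K

variable {c : ℝ} {K : ℕ} (p : unitInterval)

theorem gridValue_gridCell : gridValue c K (gridCell c K p) =
    if c ≤ p then max c (⌊(K : ℝ) * p⌋₊ / K) else ⌊(K : ℝ) * p⌋₊ / K := by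
  simp [gridValue, gridCell]

theorem floor_div_le (hK : 0 < K) : (⌊(K : ℝ) * p⌋₊ : ℝ) / K ≤ p := by
  rw [div_le_iff₀ (by exact_mod_cast hK)]
  exact (Nat.floor_le (mul_nonneg (Nat.cast_nonneg K) p.2.1)).trans_eq (mul_comm _ _)

theorem gridValue_le (hK : 0 < K) : gridValue c K (gridCell c K p) ≤ p := by
  rw [gridValue_gridCell]
  split_ifs with h
  · exact max_le h (floor_div_le p hK)
  · exact floor_div_le p hK

theorem floor_div_le_gridValue :
    (⌊(K : ℝ) * p⌋₊ : ℝ) / K ≤ gridValue c K (gridCell c K p) := by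
  rw [gridValue_gridCell]
  split_ifs
  · exact le_max_right _ _
  · exact le_rfl

theorem gridValue_nonneg : 0 ≤ gridValue c K (gridCell c K p) :=
  le_trans (by positivity) (floor_div_le_gridValue p)

theorem le_gridValue_add (hK : 0 < K) : (p : ℝ) ≤ gridValue c K (gridCell c K p) + 1 / K := by
  refine le_trans ?_ (add_le_add_left (floor_div_le_gridValue p) _)
  rw [← add_div, le_div_iff₀ (by exact_mod_cast hK), mul_comm]
  exact (Nat.lt_floor_add_one _).le

theorem le_gridValue (h : c ≤ p) : c ≤ gridValue c K (gridCell c K p) := by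
  rw [gridValue_gridCell, if_pos h]; exact le_max_left _ _

theorem gridValue_eq_one (hK : 0 < K) (h : (p : ℝ) = 1) : gridValue c K (gridCell c K p) = 1 := by
  refine le_antisymm ((gridValue_le p hK).trans h.le) ?_
  refine le_trans ?_ (floor_div_le_gridValue p)
  have : (K : ℝ) ≠ 0 := by exact_mod_cast hK.ne'
  rw [h, mul_one, Nat.floor_natCast, div_self this]

/-- The probability of accepting applicant `n` when the abilities are `θ`, rounded to the grid. -/
noncomputable def gridAcc {N : ℕ} (c : ℝ) (K : ℕ) (σ : AdminStrategy N) (s : ApplicantStrategy N)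
    (θ : Fin N → Ability) (n : Fin N) : ℝ :=
  gridValue c K (gridCell c K (σ n fun a => output σ s θ (Fin.castLE n.2 a)))

theorem acceptProb_eq_apply_output {N : ℕ} (σ : AdminStrategy N) (s : ApplicantStrategy N)
    (θ : Fin N → Ability) (n : Fin N) :
    acceptProb σ s θ n = σ n fun a => output σ s θ (Fin.castLE n.2 a) := by
  rw [acceptProb, snoc_history_output]

variable {N : ℕ} {σ : AdminStrategy N} {s : ApplicantStrategy N}

theorem gridAcc_nonneg (θ : Fin N → Ability) (n : Fin N) : 0 ≤ gridAcc c K σ s θ n :=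
  gridValue_nonneg _

theorem gridAcc_le (hK : 0 < K) (θ : Fin N → Ability) (n : Fin N) :
    gridAcc c K σ s θ n ≤ acceptProb σ s θ n := by
  rw [acceptProb_eq_apply_output]; exact gridValue_le _ hK

theorem gridAcc_le_one (hK : 0 < K) (θ : Fin N → Ability) (n : Fin N) :
    gridAcc c K σ s θ n ≤ 1 := (gridAcc_le hK θ n).trans (acceptProb_le_one σ s θ n)

/-- Rounding does not make an invitation impossible. -/
theorem reachProb_pos_of_gridAcc (hK : 0 < K) {θ : Fin N → Ability} {n : Fin N}
    (h : 0 < reachTo (gridAcc c K σ s θ) n) : 0 < reachProb σ s θ n := by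
  rw [reachProb_eq]
  refine Finset.prod_pos fun k hk => ?_
  have hne := Finset.prod_ne_zero_iff.1 h.ne' k hk
  refine sub_pos.2 ((acceptProb_le_one σ s θ k).lt_of_ne fun h1 => hne ?_)
  rw [acceptProb_eq_apply_output] at h1
  rw [gridAcc, gridValue_eq_one _ hK h1, sub_self]

theorem reach_mul_accept_le (hK : 0 < K) (θ : Fin N → Ability) (n : Fin N) :
    reachTo (acceptProb σ s θ) n * acceptProb σ s θ n ≤
      reachTo (gridAcc c K σ s θ) n * gridAcc c K σ s θ n + 1 / K := by
  have hR : reachTo (acceptProb σ s θ) n ≤ reachTo (gridAcc c K σ s θ) n :=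
    Finset.prod_le_prod (fun k _ => sub_nonneg.2 (acceptProb_le_one σ s θ k))
      fun k _ => sub_le_sub_left (gridAcc_le hK θ k) 1
  have hR0 : 0 ≤ reachTo (acceptProb σ s θ) n := reachTo_nonneg (acceptProb_le_one σ s θ) n
  have hR1 : reachTo (acceptProb σ s θ) n ≤ 1 :=
    Finset.prod_le_one (fun k _ => sub_nonneg.2 (acceptProb_le_one σ s θ k))
      fun k _ => sub_le_self _ (acceptProb_nonneg σ s θ k)
  have hp : acceptProb σ s θ n ≤ gridAcc c K σ s θ n + 1 / K := by
    rw [acceptProb_eq_apply_output]; exact le_gridValue_add _ hK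
  have hK0 : (0 : ℝ) ≤ 1 / K := by positivity
  have hg := gridAcc_nonneg (c := c) (K := K) (σ := σ) (s := s) θ n
  nlinarith [mul_le_mul_of_nonneg_left hp hR0, mul_le_mul_of_nonneg_right hR hg,
    mul_le_mul_of_nonneg_right hR1 hK0]

/-- An applicant who completes the interview as a best response is accepted with probability at
least `c`. -/
theorem le_acceptProb_of_completes (hbr : ApplicantsBestRespond c σ s) {θ : Fin N → Ability}
    (hθ : Function.Injective θ) {n : Fin N} (hn : 0 < reachProb σ s θ n)
    (ha : playedAction σ s θ n = true) : c ≤ acceptProb σ s θ n := by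
  have h := hbr θ hθ n hn false
  rw [playedAction] at ha
  rw [acceptProb_eq]
  rw [ha] at h ⊢
  simp only [applicantPayoff, Bool.false_eq_true, if_false, if_true, sub_zero] at h
  have h0 := (σ n (Fin.snoc (α := fun _ => ℝ≥0) (history σ s θ n) (outputOf false (θ n)))).2.1
  linarith

/-- By Ramsey's theorem, any two strategies are order-invariant, up to rounding, on suitable
abilities. -/
theorem exists_ordinalPlay (hK : 0 < K) (hbr : ApplicantsBestRespond c σ s) :
    ∃ (w : Fin N → Ability) (P : OrdinalPlay N c), StrictMono w ∧
      ∀ τ n, P.acc τ n = gridAcc c K σ s (fun k => w (τ k)) n := by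
  classical
  let out : {m : ℕ} → (Fin m → Bool) → (Fin m → ℕ) → Fin m → ℝ≥0 :=
    fun Z x a => outputOf (Z a) (abilitySeq (x a))
  have hout : ∀ {m : ℕ} (Z : Fin m → Bool) (x x' : Fin m → ℕ) (a : Fin m),
      (Z a = true → x a = x' a) → out Z x a = out Z x' a := fun Z x x' a h => by
    by_cases hZ : Z a = true
    · simp only [out, h hZ]
    · simp only [out, outputOf, hZ, Bool.false_eq_true, if_false]
  let G : (n : Fin N) → (Fin (n + 1) → Bool) → (Fin (n + 1) → ℕ) →
      Bool × (Bool × Fin (K + 1)) := fun n Z x =>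
    (if Z (Fin.last n) = true then
        s σ n (fun k => out Z x k.castSucc) (abilitySeq (x (Fin.last n))) else true,
      gridCell c K (σ n (out Z x)))
  obtain ⟨e, he⟩ := exists_orderEmbedding_invariant (fun n : Fin N => (n : ℕ) + 1) G (by
    intro n Z x x' h
    have h1 : out Z x = out Z x' := funext fun a => hout Z x x' a (h a)
    simp only [G, h1]
    split_ifs with hl
    · rw [h _ hl]
    · rfl)
  let w : Fin N → Ability := fun i => abilitySeq (e i)
  have hw : StrictMono w := fun i j hij =>
    strictMono_abilitySeq (e.lt_iff_lt.2 (Fin.lt_def.1 hij))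
  let θ : Equiv.Perm (Fin N) → Fin N → Ability := fun τ k => w (τ k)
  have hθ : ∀ τ, Function.Injective (θ τ) := fun τ => hw.injective.comp τ.injective
  let A : Equiv.Perm (Fin N) → Fin N → Bool := fun τ n => playedAction σ s (θ τ) n
  let x : (n : Fin N) → Equiv.Perm (Fin N) → Fin (n + 1) → ℕ :=
    fun n τ a => (τ (Fin.castLE n.2 a) : ℕ)
  let P : OrdinalPlay N c :=
    { act := A
      acc := fun τ n => gridAcc c K σ s (θ τ) n
      acc_nonneg := fun τ n => gridAcc_nonneg _ n
      acc_le_one := fun τ n => gridAcc_le_one hK _ n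
      act_eq := by
        intro τ π n hA hlt
        -- the action of applicant `n` is the value of `G` at the outputs of the predecessors and
        -- the ability of `n`
        let Z : Equiv.Perm (Fin N) → Fin (n + 1) → Bool := fun τ a =>
          if (a : ℕ) < n then A τ (Fin.castLE n.2 a) else true
        have hact : ∀ τ, A τ n = (G n (Z τ) fun a => e (x n τ a)).1 := by
          intro τ
          have hlast : Z τ (Fin.last n) = true := by simp [Z]
          have hhist : history σ s (θ τ) n =
              fun k => out (Z τ) (fun a => e (x n τ a)) k.castSucc := by
            funext k
            have : Z τ k.castSucc = A τ ⟨k, k.2.trans n.2⟩ := by simp [Z]; rfl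
            simp only [history, output_eq, out, this]
            rfl
          simp only [G, hlast, if_true, ← hhist]
          rfl
        have hZ : Z τ = Z π := by
          funext a
          simp only [Z]
          split_ifs with h
          · exact hA _ (Fin.lt_def.2 h)
          · rfl
        rw [hact, hact, ← hZ]
        refine congrArg Prod.fst (he n (Z τ) _ _ fun a b ha hb => ?_)
        have hrel : ∀ a : Fin (n + 1), Z τ a = true →
            (Fin.castLE n.2 a < n ∧ A τ (Fin.castLE n.2 a) = true ∨ Fin.castLE n.2 a = n) := by
          intro a ha
          by_cases h : (a : ℕ) < n
          · simp only [Z, if_pos h] at ha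
            exact Or.inl ⟨Fin.lt_def.2 h, ha⟩
          · exact Or.inr (Fin.ext (le_antisymm (Nat.lt_succ_iff.1 a.2) (not_lt.1 h)))
        simpa only [x, Fin.lt_def] using hlt _ _ (hrel a ha) (hrel b hb)
      acc_eq := by
        intro τ π n hA hlt
        -- here the relevant coordinates are those up to `n` whose applicants complete
        let Z : Equiv.Perm (Fin N) → Fin (n + 1) → Bool := fun τ a => A τ (Fin.castLE n.2 a)
        have hacc : ∀ τ, gridAcc c K σ s (θ τ) n =
            gridValue c K (G n (Z τ) fun a => e (x n τ a)).2 := by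
          intro τ
          have : (fun a => output σ s (θ τ) (Fin.castLE n.2 a)) =
              out (Z τ) fun a => e (x n τ a) := by
            funext a
            rw [output_eq]
          rw [gridAcc, this]
        have hle : ∀ a : Fin (n + 1), Fin.castLE n.2 a ≤ n := fun a =>
          Fin.le_def.2 (Nat.lt_succ_iff.1 a.2)
        have hZ : Z τ = Z π := funext fun a => hA _ (hle a)
        rw [hacc, hacc, ← hZ]
        refine congrArg (fun g => gridValue c K g.2) (he n (Z τ) _ _ fun a b ha hb => ?_)
        simpa only [x, Fin.lt_def] using hlt _ _ (hle a) (hle b) ha hb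
      le_acc := by
        intro τ n hreach ha
        have h := le_acceptProb_of_completes hbr (hθ τ) (reachProb_pos_of_gridAcc hK hreach) ha
        rw [acceptProb_eq_apply_output] at h
        exact le_gridValue _ h }
  exact ⟨w, P, hw, fun τ n => rfl⟩

/-- Best responding applicants leave the administrator at most the value of full learning. The bound
holds up to `N / K` for the grid of width `1 / K`. -/
theorem successProb_le_of_applicantsBestRespond (hc : c ≤ 1)
    (hbr : ApplicantsBestRespond c σ s) : successProb σ s ≤ fullLearningValue N c := by
  have hbound : ∀ K : ℕ, 0 < K → successProb σ s ≤ fullLearningValue N c + N * (1 / K) := by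
    intro K hK
    obtain ⟨w, P, hw, hP⟩ := exists_ordinalPlay hK hbr
    refine (ciInf_le (bddBelow_successProbAt σ s) ⟨w, hw.injective⟩).trans ?_
    have hfac : (0 : ℝ) < N.factorial := by exact_mod_cast N.factorial_pos
    rw [successProbAt, div_le_iff₀ hfac]
    have hτ : ∀ τ : Equiv.Perm (Fin N), successGiven σ s (fun n => w (τ n)) ≤
        (∑ m : Fin N, reachTo (P.acc τ) m * P.acc τ m * bestInd τ m) + N * (1 / K) := by
      intro τ
      have hPτ : P.acc τ = gridAcc c K σ s fun k => w (τ k) := funext (hP τ)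
      have hN : (N : ℝ) * (1 / K) = ∑ _m : Fin N, (1 / K : ℝ) := by simp
      rw [successGiven_eq σ s hw, hPτ, hN, ← Finset.sum_add_distrib]
      refine Finset.sum_le_sum fun m _ => ?_
      have hle := reach_mul_accept_le (c := c) (σ := σ) (s := s) hK (fun k => w (τ k)) m
      unfold bestInd
      split_ifs
      · simpa using hle
      · simp
    refine (Finset.sum_le_sum fun τ _ => hτ τ).trans ?_
    rw [Finset.sum_add_distrib, Finset.sum_const, Finset.card_univ, Fintype.card_perm,
      Fintype.card_fin, nsmul_eq_mul]
    have := P.sum_success_le hc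
    linarith
  have hlim : Filter.Tendsto (fun K : ℕ => fullLearningValue N c + N * (1 / (K : ℝ)))
      Filter.atTop (nhds (fullLearningValue N c + N * 0)) :=
    (tendsto_one_div_atTop_nhds_zero_nat.const_mul _).const_add _
  rw [mul_zero, add_zero] at hlim
  exact ge_of_tendsto hlim (Filter.eventually_atTop.2 ⟨1, fun K hK => hbound K hK⟩)

end UpperBound

/-! ### Strategies that accept only record outputs -/

section RecordStrategy

variable {N : ℕ}

open scoped Classical in
/-- The strategy that accepts applicant `n` with probability `q n` if the output is positive and
maximal so far, and rejects `n` otherwise. -/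
noncomputable def recordStrategy (N : ℕ) (q : ℕ → unitInterval) : AdminStrategy N := fun n y =>
  if 0 < y (Fin.last n) ∧ ∀ k, y k ≤ y (Fin.last n) then q n else 0

theorem thresholdStrategy_eq (c : unitInterval) : thresholdStrategy N c =
    recordStrategy N fun n => if threshold N ≤ n + 1 then 1 else c := rfl

theorem applicantsBestRespond_optimalResponse (c : ℝ) (σ : AdminStrategy N) :
    ApplicantsBestRespond c σ (optimalResponse N c) := by
  intro θ _ n _ a
  unfold optimalResponse
  set h := history σ _ θ n
  rcases lt_trichotomy (applicantPayoff c σ n h (θ n) false) (applicantPayoff c σ n h (θ n) true)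
    with hlt | heq | hgt
  · cases a <;> simp [hlt, hlt.le]
  · cases a <;> by_cases hk : ∀ k, h k < (θ n : ℝ≥0) <;> simp [heq, hk]
  · cases a <;> simp [hgt.not_gt, hgt.ne', hgt.le]

variable {σ : AdminStrategy N} {s : ApplicantStrategy N} {θ : Fin N → Ability} {n : Fin N}

theorem reachProb_pos_of_le (h : 0 < reachProb σ s θ n) {k : Fin N} (hk : k ≤ n) :
    0 < reachProb σ s θ k := by
  refine Finset.prod_pos fun i hi => ?_
  have hin : i ∈ Finset.Iio n := Finset.mem_Iio.2 ((Finset.mem_Iio.1 hi).trans_le hk)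
  exact lt_of_le_of_ne (sub_nonneg.2 (acceptProb_le_one σ s θ i))
    (Finset.prod_ne_zero_iff.1 h.ne' i hin).symm

/-- If, as long as the game lasts, applicant `n` is accepted with probability `p n` when better than
all predecessors and rejected otherwise, then the success probability is the value of the
policy `p`, whatever the values of the abilities. -/
theorem successProbAt_eq_policyValue (p : ℕ → ℝ)
    (h : ∀ θ : Fin N → Ability, Function.Injective θ → ∀ n : Fin N, 0 < reachProb σ s θ n →
      acceptProb σ s θ n = if ∀ k < n, θ k < θ n then p n else 0) (w : Fin N ↪ Ability) :
    successProbAt σ s w = policyValue N p N := by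
  obtain ⟨w', hw', hw⟩ := exists_strictMono_successProbAt_eq w
  have hfac : (N.factorial : ℝ) ≠ 0 := by exact_mod_cast N.factorial_ne_zero
  rw [hw s σ, div_eq_iff hfac, mul_comm]
  have hmain := sum_success_recordAcc (N := N) (fun n => p n) (fun n => policyValue N p (N - n))
    (by simp [policyValue]) fun n => policyValue_rec p n
  simp only [Nat.sub_zero] at hmain
  rw [← hmain]
  refine Finset.sum_congr rfl fun τ _ => ?_
  rw [successGiven_eq σ s hw']
  set θ : Fin N → Ability := fun n => w' (τ n) with hθdef
  have hθ : Function.Injective θ := hw'.injective.comp τ.injective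
  have hacc : ∀ n : Fin N, reachTo (acceptProb σ s θ) n ≠ 0 →
      acceptProb σ s θ n = recordAcc (fun n => p n) τ n := fun n hn => by
    rw [← reachProb_eq] at hn
    rw [h θ hθ n (lt_of_le_of_ne (reachProb_nonneg σ s θ n) hn.symm)]
    simp only [recordAcc, hθdef, hw'.lt_iff_lt]
  have hreach : ∀ m : ℕ, m ≤ N → reachTo (acceptProb σ s θ) m =
      reachTo (recordAcc (fun n => p n) τ) m := by
    intro m
    induction m with
    | zero => intro _; rw [reachTo_zero, reachTo_zero]
    | succ m ih =>
      intro hm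
      have ih' := ih (by omega)
      have e1 := reachTo_succ (acceptProb σ s θ) ⟨m, hm⟩
      have e2 := reachTo_succ (recordAcc (fun n => p n) τ) ⟨m, hm⟩
      simp only at e1 e2
      rw [e1, e2, ← ih']
      by_cases h0 : reachTo (acceptProb σ s θ) m = 0
      · rw [h0, zero_mul, zero_mul]
      · rw [hacc ⟨m, hm⟩ h0]
  refine Finset.sum_congr rfl fun m _ => ?_
  rw [← hreach m m.2.le]
  by_cases h0 : reachTo (acceptProb σ s θ) m = 0
  · simp only [h0, zero_mul]
  · rw [hacc m h0]

variable {q : ℕ → unitInterval} {c : ℝ}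

theorem outputOf_le (a : Bool) (θ : Ability) : outputOf a θ ≤ θ := by
  cases a <;> simp [outputOf]

theorem output_le (σ : AdminStrategy N) (s : ApplicantStrategy N) (θ : Fin N → Ability)
    (n : Fin N) : output σ s θ n ≤ θ n := by
  rw [output_eq]; exact outputOf_le _ _

theorem applicantPayoff_recordStrategy_false (hh : Fin n → ℝ≥0) (t : Ability) :
    applicantPayoff c (recordStrategy N q) n hh t false = 0 := by
  simp [applicantPayoff, recordStrategy, outputOf]

theorem applicantPayoff_recordStrategy_true {hh : Fin n → ℝ≥0} {t : Ability}
    (ht : ∀ k, hh k < t) : applicantPayoff c (recordStrategy N q) n hh t true = q n - c := by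
  have hrec : 0 < (Fin.snoc (α := fun _ => ℝ≥0) hh (outputOf true t) : Fin (n + 1) → ℝ≥0)
      (Fin.last n) ∧ ∀ k, (Fin.snoc (α := fun _ => ℝ≥0) hh (outputOf true t) :
        Fin (n + 1) → ℝ≥0) k ≤ (Fin.snoc (α := fun _ => ℝ≥0) hh (outputOf true t) :
          Fin (n + 1) → ℝ≥0) (Fin.last n) := by
    rw [Fin.snoc_last]
    refine ⟨t.2, fun k => Fin.lastCases ?_ (fun k => ?_) k⟩
    · rw [Fin.snoc_last]
    · rw [Fin.snoc_castSucc]; exact (ht k).le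
  rw [applicantPayoff, recordStrategy, if_pos hrec, if_pos rfl]

/-- The best applicants so far complete the interview, as long as the game lasts. -/
def RecordsComplete (σ : AdminStrategy N) (s : ApplicantStrategy N) : Prop :=
  ∀ θ : Fin N → Ability, Function.Injective θ → ∀ n : Fin N, 0 < reachProb σ s θ n →
    (∀ k < n, θ k < θ n) → playedAction σ s θ n = true

theorem history_lt_of_record (hrec : ∀ k < n, θ k < θ n) (k : Fin n) :
    history σ s θ n k < θ n :=
  (output_le σ s θ _).trans_lt (hrec _ (Fin.lt_def.2 k.2))

theorem recordsComplete_of_lt (hq : ∀ n < N, c < q n)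
    (hbr : ApplicantsBestRespond c (recordStrategy N q) s) :
    RecordsComplete (recordStrategy N q) s := by
  intro θ hθ n hn hrec
  by_contra hne
  have h := hbr θ hθ n hn true
  rw [playedAction, Bool.not_eq_true] at hne
  rw [hne, applicantPayoff_recordStrategy_false,
    applicantPayoff_recordStrategy_true (history_lt_of_record hrec)] at h
  linarith [hq n n.2]

theorem recordsComplete_optimalResponse (hq : ∀ n, c ≤ q n) :
    RecordsComplete (recordStrategy N q) (optimalResponse N c) := by
  intro θ hθ n hn hrec
  have hh := history_lt_of_record (σ := recordStrategy N q) (s := optimalResponse N c) hrec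
  unfold playedAction
  rw [optimalResponse, decide_eq_true_iff, applicantPayoff_recordStrategy_false,
    applicantPayoff_recordStrategy_true hh]
  rcases (hq n).lt_or_eq with hlt | heq
  · exact Or.inl (sub_pos.2 hlt)
  · exact Or.inr ⟨(sub_eq_zero.2 heq.symm).symm, hh⟩

/-- The output of the best applicant up to `n` is that applicant's ability. -/
theorem RecordsComplete.exists_output_eq (h : RecordsComplete σ s) (hθ : Function.Injective θ)
    (hn : 0 < reachProb σ s θ n) :
    ∃ k ≤ n, (∀ i ≤ n, θ i ≤ θ k) ∧ output σ s θ k = θ k := by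
  obtain ⟨k, hk, hmax⟩ := Finset.exists_max_image (Finset.Iic n) θ ⟨n, Finset.mem_Iic.2 le_rfl⟩
  have hkn := Finset.mem_Iic.1 hk
  refine ⟨k, hkn, fun i hi => hmax i (Finset.mem_Iic.2 hi), ?_⟩
  have ha := h θ hθ k (reachProb_pos_of_le hn hkn) fun i hi =>
    (hmax i (Finset.mem_Iic.2 (hi.le.trans hkn))).lt_of_ne fun he => hi.ne (hθ he)
  rw [output_eq, ha]
  rfl

theorem RecordsComplete.isFullLearning (h : RecordsComplete σ s) : IsFullLearning σ s := by
  intro θ hθ n hn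
  obtain ⟨k, hk, hmax, hout⟩ := h.exists_output_eq hθ hn
  refine le_antisymm (Finset.sup_le fun i hi => ?_)
    (Finset.sup_mono_fun fun i _ => output_le σ s θ i)
  calc (θ i : ℝ≥0) ≤ θ k := hmax i (Finset.mem_Iic.1 hi)
    _ = output σ s θ k := hout.symm
    _ ≤ _ := Finset.le_sup (f := fun k => output σ s θ k) (Finset.mem_Iic.2 hk)

theorem RecordsComplete.acceptProb_eq (h : RecordsComplete (recordStrategy N q) s)
    (hθ : Function.Injective θ) (hn : 0 < reachProb (recordStrategy N q) s θ n) :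
    acceptProb (recordStrategy N q) s θ n =
      if ∀ k < n, θ k < θ n then (q n : ℝ) else 0 := by
  split_ifs with hrec
  · have ha := h θ hθ n hn hrec
    have hpay := applicantPayoff_recordStrategy_true (c := 0) (q := q)
      (history_lt_of_record (σ := recordStrategy N q) (s := s) hrec)
    rw [playedAction] at ha
    rw [HiringGame.acceptProb_eq, ha]
    simpa [applicantPayoff] using hpay
  · obtain ⟨k, hk, hmax, hout⟩ := h.exists_output_eq hθ hn
    have hkn : θ n < θ k := (hmax n le_rfl).lt_of_ne fun he => hrec fun i hi =>
      (he ▸ hmax i hi.le).lt_of_ne fun he' => hi.ne (hθ he')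
    have hzero : recordStrategy N q n
        (fun a => output (recordStrategy N q) s θ (Fin.castLE n.2 a)) = 0 := by
      refine if_neg ?_
      rintro ⟨-, hall⟩
      have h1 := hall ⟨k, Nat.lt_succ_of_le hk⟩
      change output _ s θ k ≤ output _ s θ n at h1
      rw [hout] at h1
      exact (h1.trans (output_le _ s θ n)).not_gt hkn
    rw [acceptProb_eq_apply_output, hzero]
    rfl

theorem RecordsComplete.successProbAt_eq (h : RecordsComplete (recordStrategy N q) s)
    (w : Fin N ↪ Ability) :
    successProbAt (recordStrategy N q) s w = policyValue N (fun n => q n) N :=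
  successProbAt_eq_policyValue _ (fun _ hθ _ hn => h.acceptProb_eq hθ hn) w

theorem successProb_eq_of_forall {v : ℝ} (h : ∀ w : Fin N ↪ Ability, successProbAt σ s w = v) :
    successProb σ s = v := by
  have : Nonempty (Fin N ↪ Ability) :=
    ⟨⟨fun i => abilitySeq i, strictMono_abilitySeq.injective.comp Fin.val_injective⟩⟩
  rw [successProb]
  simp only [h, ciInf_const]

/-- If the applicants best respond to every strategy, then the administrator can secure the value of
full learning up to an arbitrarily small loss, by giving the best applicants so far a strict
incentive to complete the interview. -/
theorem fullLearningValue_le_of_nash {c : unitInterval} (hN : 0 < N) (hc : c < 1)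
    (hnash : ∀ σ' : AdminStrategy N, successProb σ' s ≤ successProb σ s)
    (hbr : ∀ σ' : AdminStrategy N, ApplicantsBestRespond (c : ℝ) σ' s) :
    fullLearningValue N c ≤ successProb σ s := by
  let p : ℝ → ℕ → ℝ := fun ε n => if threshold N ≤ n + 1 then 1 else c + ε
  have hcont : Continuous fun ε => policyValue N (p ε) N :=
    continuous_policyValue (fun n => by
      simp only [p]
      split_ifs <;> fun_prop) N
  have hp0 : policyValue N (p 0) N = fullLearningValue N c := by
    simp only [p, add_zero]
    exact policyValue_threshold c.2.2 hN
  have hlim : Filter.Tendsto (fun ε => policyValue N (p ε) N) (nhdsWithin 0 (Set.Ioi 0))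
      (nhds (fullLearningValue N c)) := hp0 ▸ (hcont.tendsto 0).mono_left nhdsWithin_le_nhds
  have hc' : (c : ℝ) < 1 := hc
  refine le_of_tendsto hlim ?_
  filter_upwards [Ioo_mem_nhdsGT (sub_pos.2 hc')] with ε hε
  let q : ℕ → unitInterval := fun n =>
    if threshold N ≤ n + 1 then 1 else ⟨c + ε, by linarith [c.2.1, hε.1], by linarith [hε.2]⟩
  have hq : (fun n => (q n : ℝ)) = p ε := by
    funext n
    simp only [q, p]
    split_ifs <;> rfl
  have hrc : RecordsComplete (recordStrategy N q) s := by
    refine recordsComplete_of_lt (fun n _ => ?_) (hbr _)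
    rw [show (q n : ℝ) = p ε n from congrFun hq n]
    simp only [p]
    split_ifs
    · exact hc'
    · linarith [hε.1]
  rw [← hq, ← successProb_eq_of_forall hrc.successProbAt_eq]
  exact hnash _

end RecordStrategy

end HiringGame

theorem mainTheorem3 (N : ℕ) (hN : 2 ≤ N) (c : unitInterval) (hc : c < 1) :
    -- the threshold profile is a full learning equilibrium whose applicants best respond to every
    -- strategy of the administrator, and its success probability is `π*_N` for all ability values
    (HiringGame.IsFullLearningEquilibrium (c : ℝ)
        (HiringGame.thresholdStrategy N c) (HiringGame.optimalResponse N c) ∧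
      (∀ σ : HiringGame.AdminStrategy N,
        HiringGame.ApplicantsBestRespond (c : ℝ) σ (HiringGame.optimalResponse N c)) ∧
      (∀ w : Fin N ↪ HiringGame.Ability,
        HiringGame.successProbAt (HiringGame.thresholdStrategy N c)
          (HiringGame.optimalResponse N c) w = HiringGame.fullLearningValue N c) ∧
      HiringGame.successProb (HiringGame.thresholdStrategy N c)
        (HiringGame.optimalResponse N c) = HiringGame.fullLearningValue N c) ∧
    -- every full learning equilibrium whose applicants best respond to every strategy of the
    -- administrator has that success probability
    (∀ (σ : HiringGame.AdminStrategy N) (s : HiringGame.ApplicantStrategy N),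
      HiringGame.IsFullLearningEquilibrium (c : ℝ) σ s →
      (∀ σ' : HiringGame.AdminStrategy N, HiringGame.ApplicantsBestRespond (c : ℝ) σ' s) →
      HiringGame.successProb σ s = HiringGame.fullLearningValue N c) ∧
    -- no Nash equilibrium has a higher success probability
    (∀ (σ : HiringGame.AdminStrategy N) (s : HiringGame.ApplicantStrategy N),
      HiringGame.IsNashEquilibrium (c : ℝ) σ s →
      HiringGame.successProb σ s ≤ HiringGame.fullLearningValue N c) ∧
    -- nor does any profile in which the applicants best respond to the administrator's strategy
    (∀ (σ : HiringGame.AdminStrategy N) (s : HiringGame.ApplicantStrategy N),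
      HiringGame.ApplicantsBestRespond (c : ℝ) σ s →
      HiringGame.successProb σ s ≤ HiringGame.fullLearningValue N c) := by
  have hN0 : 0 < N := by omega
  have hupper : ∀ (σ : HiringGame.AdminStrategy N) (s : HiringGame.ApplicantStrategy N),
      HiringGame.ApplicantsBestRespond (c : ℝ) σ s →
      HiringGame.successProb σ s ≤ HiringGame.fullLearningValue N c := fun σ s hbr =>
    HiringGame.successProb_le_of_applicantsBestRespond c.2.2 hbr
  have hbr := HiringGame.applicantsBestRespond_optimalResponse (N := N) (c : ℝ)
  have hrc : HiringGame.RecordsComplete (HiringGame.thresholdStrategy N c)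
      (HiringGame.optimalResponse N c) := by
    rw [HiringGame.thresholdStrategy_eq]
    refine HiringGame.recordsComplete_optimalResponse fun n => ?_
    split_ifs
    · exact c.2.2
    · exact le_rfl
  have hval : ∀ w : Fin N ↪ HiringGame.Ability,
      HiringGame.successProbAt (HiringGame.thresholdStrategy N c)
        (HiringGame.optimalResponse N c) w = HiringGame.fullLearningValue N c := by
    rw [HiringGame.thresholdStrategy_eq] at hrc ⊢
    intro w
    rw [hrc.successProbAt_eq w, ← HiringGame.policyValue_threshold c.2.2 hN0]
    congr 1
    funext n
    split_ifs <;> rfl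
  have hsucc := HiringGame.successProb_eq_of_forall hval
  refine ⟨⟨⟨⟨hbr _, fun σ' => ?_⟩, hrc.isFullLearning⟩, hbr, hval, hsucc⟩, ?_,
    fun σ s h => hupper σ s h.1, hupper⟩
  · rw [hsucc]; exact hupper σ' _ (hbr σ')
  · intro σ s h hall
    exact le_antisymm (hupper σ s h.1.1)
      (HiringGame.fullLearningValue_le_of_nash hN0 hc h.1.2 hall)
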